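/- Let $R$ be a commutative ring and let $C(R)$ be the category of (possibly unbounded) cochain complexes of $R$-modules. A complex $A^\bullet\in C(R)$ is \emph{pure acyclic} if $N\otimes_R A^\bullet$ is acyclic for every $R$-module $N$, and a morphism of $C(R)$ is a \emph{pure quasi-isomorphism} if its mapping cone is pure acyclic. For $M^\bullet,N^\bullet\in C(R)$, $\mathrm{Hom}_R^\bullet(M^\bullet,N^\bullet)\in C(R)$ denotes the complex with $\mathrm{Hom}_R^i(M^\bullet,N^\bullet)=\prod_{j\in\mathbb Z}\mathrm{Hom}_R(M^j,N^{i+j})$ and $d^i(f)=d_N\circ f-(-1)^i f\circ d_M$. A complex $I^\bullet$ is \emph{$K$-pure injective} if $\mathrm{Hom}_R^\bullet(A^\bullet,I^\bullet)$ is pure acyclic for every pure acyclic $A^\bullet$; a module is \emph{pure injective} if it is $K$-pure injective as a complex concentrated in degree $0$. A \emph{pure injective resolution} of $M^\bullet$ is a pure quasi-isomorphism $g\colon M^\bullet\to I^\bullet$ such that $I^\bullet$ is a $K$-pure injective complex and every $I^j$ is a pure injective module. An inverse system $\{I_n^\bullet\}_{n\ge 0}$ in $C(R)$ is a \emph{special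 inverse system of $K$-pure injective complexes} if, with $I_{-1}^\bullet:=0$, for every $n\geq 0$ the map $I_n^\bullet\to I_{n-1}^\bullet$ is surjective, its kernel is $K$-pure injective, and the short exact sequence $0\to \mathrm{Ker}\to I_n^\bullet\to I_{n-1}^\bullet\to 0$ splits in each degree. Finally, $\tau^{\ge n}M^\bullet$ is the complex that is $M^i$ in degrees $i>n$, $\mathrm{Coker}(d^{n-1})$ in degree $n$ and $0$ in degrees $i<n$. \textbf{Theorem.} Every complex $M^\bullet\in C(R)$ has a pure injective resolution $g\colon M^\bullet\to I^\bullet$. Moreover, $g$ can be chosen as follows: there are a special inverse system $\{I_n^\bullet\}_{n\ge 0}$ of $K$-pure injective complexes and a morphism $\{f_n\colon \tau^{\ge -n}M^\bullet\to I_n^\bullet\}_{n\ge 0}$ of inverse systems such that, for every $n\geq 0$, $I_n^\bullet$ is bounded below and $f_n$ is a pure injective resolution of $\tau^{\ge -n}M^\bullet$, such that $I^\bullet=\varprojlim_{n\ge 0} I_n^\bullet$, and such that, for every $n\geq 0$, the composite of $g$ with the projection $I^\bullet\to I_n^\bullet$ is the composite $M^\bullet\to\tau^{\ge -n}M^\bullet\xrightarrow{f_n}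 I_n^\bullet$. -/

import Mathlib

open CategoryTheory CategoryTheory.Limits

universe u

namespace PureRes

/-- The category `C(R)` of (unbounded) cochain complexes of `R`-modules. -/
abbrev Cplx (R : Type u) [CommRing R] := CochainComplex (ModuleCat.{u} R) ℤ

section

variable {R : Type u} [CommRing R]

/-- The complex `N ⊗_R M^•` for a module `N` and a complex `M^•`. -/
noncomputable def tensorCplx (N : ModuleCat.{u} R) (M : Cplx R) : Cplx R :=
  ((MonoidalCategory.tensorLeft N).mapHomologicalComplex (ComplexShape.up ℤ)).obj M

/-- A complex is pure acyclic if it stays acyclic after tensoring with any module. -/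
def IsPureAcyclic (M : Cplx R) : Prop :=
  ∀ N : ModuleCat.{u} R, (tensorCplx N M).Acyclic

/-- A morphism of complexes is a pure quasi-isomorphism if its mapping cone is pure acyclic. -/
def IsPureQuasiIso {M N : Cplx R} (f : M ⟶ N) : Prop :=
  IsPureAcyclic (CochainComplex.mappingCone f)

/-- The internal Hom complex of `R`-modules: in degree `i` it is `∏_j Hom_R(M^j, N^{i+j})`, and
its differential is `f ↦ d_N ∘ f - (-1)^i f ∘ d_M`. -/
noncomputable def homCplx (M N : Cplx R) : Cplx R where
  X i := ModuleCat.of R (CochainComplex.HomComplex.Cochain M N i)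
  d i j := ModuleCat.ofHom (CochainComplex.HomComplex.δ_hom R M N i j)
  shape i j hij := by
    refine ModuleCat.hom_ext (LinearMap.ext fun z => ?_)
    exact CochainComplex.HomComplex.δ_shape i j hij z
  d_comp_d' i j k _ _ := by
    refine ModuleCat.hom_ext (LinearMap.ext fun z => ?_)
    exact CochainComplex.HomComplex.δ_δ i j k z

/-- A complex `I^•` is `K`-pure injective if the functor `Hom_R^•(_, I^•)` takes pure acyclic
complexes to pure acyclic complexes. -/
def IsKPureInjective (I : Cplx R) : Prop :=
  ∀ A : Cplx R, IsPureAcyclic A → IsPureAcyclic (homCplx A I)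

/-- A module `E` is pure injective if the functor `Hom_R^•(_, E)` preserves pure acyclic
complexes, where `E` is seen as a complex concentrated in degree `0`. -/
def IsPureInjective (E : ModuleCat.{u} R) : Prop :=
  ∀ A : Cplx R, IsPureAcyclic A →
    IsPureAcyclic (homCplx A ((CochainComplex.singleFunctor (ModuleCat.{u} R) 0).obj E))

/-- A morphism `g : M^• ⟶ I^•` is a pure injective resolution of `M^•`. -/
structure IsPureInjectiveResolution {M I : Cplx R} (g : M ⟶ I) : Prop where
  pureInjective : ∀ i : ℤ, IsPureInjective (I.X i)
  pureQuasiIso : IsPureQuasiIso g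
  kPureInjective : IsKPureInjective I

/-- `I^•` is bounded below: `I^i` vanishes for all sufficiently small `i`. -/
def IsBoundedBelow (I : Cplx R) : Prop :=
  ∃ a : ℤ, ∀ i : ℤ, i < a → IsZero (I.X i)

/-- The transition morphism `I_{n+1}^• ⟶ I_n^•` of an inverse system of complexes. -/
abbrev transition (I : ℕᵒᵖ ⥤ Cplx R) (n : ℕ) :
    I.obj (Opposite.op (n + 1)) ⟶ I.obj (Opposite.op n) :=
  I.map (homOfLE n.le_succ).op

/-- The sequence `Ker p ⟶ X^• ⟶ Y^•` of complexes attached to `p : X^• ⟶ Y^•`. -/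
noncomputable def kernelSequence {X Y : Cplx R} (p : X ⟶ Y) : ShortComplex (Cplx R) :=
  ShortComplex.mk (kernel.ι p) p (kernel.condition p)

/-- An inverse system `{I_n^•}_{n ≥ 0}` of complexes is `T`-special if, for all `n ≥ 0`, the map
`I_n^• ⟶ I_{n-1}^•` is surjective, its kernel is in `T`, and the resulting short exact sequence
is split in each degree. Here `I_{-1}^• = 0`, so that the conditions for `n = 0` say precisely
that `I_0^•` is in `T`. -/
structure IsSpecialInverseSystem (T : Cplx R → Prop) (I : ℕᵒᵖ ⥤ Cplx R) : Prop where
  zero : T (I.obj (Opposite.op 0))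
  surjective : ∀ (n : ℕ) (i : ℤ), Function.Surjective ((transition I n).f i)
  kernel_mem : ∀ n : ℕ, T (kernel (transition I n))
  semiSplit : ∀ (n : ℕ) (i : ℤ), Nonempty
    ((kernelSequence (transition I n)).map
      (HomologicalComplex.eval (ModuleCat.{u} R) (ComplexShape.up ℤ) i)).Splitting

/-- The canonical morphism `τ^{≥ m} M^• ⟶ τ^{≥ n} M^•` for `m ≤ n`. As `τ^{≥ n} M^•` vanishes
in degrees `< m`, it is canonically isomorphic to `τ^{≥ m} τ^{≥ n} M^•`. -/
noncomputable def truncTransition (M : Cplx R) {m n : ℤ} (h : m ≤ n) :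
    M.truncGE m ⟶ M.truncGE n :=
  haveI : (M.truncGE n).IsStrictlyGE m := (M.truncGE n).isStrictlyGE_of_ge m n h
  CochainComplex.truncGEMap (M.πTruncGE n) m ≫ inv ((M.truncGE n).πTruncGE m)

/-- The morphism `τ^{≥ m} M^• ⟶ τ^{≥ n} M^•` is compatible with the projections from `M^•`. -/
lemma π_truncTransition (M : Cplx R) {m n : ℤ} (h : m ≤ n) :
    M.πTruncGE m ≫ truncTransition M h = M.πTruncGE n := by
  have : (M.truncGE n).IsStrictlyGE m := (M.truncGE n).isStrictlyGE_of_ge m n h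
  rw [truncTransition, ← Category.assoc, CochainComplex.πTruncGE_naturality, Category.assoc,
    IsIso.hom_inv_id, Category.comp_id]

instance epi_πTruncGE (M : Cplx R) (n : ℤ) : Epi (M.πTruncGE n) :=
  inferInstanceAs (Epi (HomologicalComplex.πTruncGE M (ComplexShape.embeddingUpIntGE n)))

/-- The inverse system `{τ^{≥ -n} M^•}_{n ≥ 0}`. -/
noncomputable def truncSystem (M : Cplx R) : ℕᵒᵖ ⥤ Cplx R where
  obj n := M.truncGE (-(n.unop : ℤ))
  map {a b} f := truncTransition M (by have := f.unop.le; omega)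
  map_id a := by
    rw [← cancel_epi (M.πTruncGE _), π_truncTransition, Category.comp_id]
  map_comp f g := by
    rw [← cancel_epi (M.πTruncGE _), π_truncTransition, ← Category.assoc, π_truncTransition,
      π_truncTransition]

end

end PureRes

/-!
If all the complexes `Hom(P, X)` with `P` finitely presented are exact, then `X` is pure acyclic;
this stronger exactness is convenient because `Hom(P, _)` commutes with products and limits.

Every module embeds purely into its double character module, which is pure injective. Splicing the
resulting short exact sequences of complexes yields a double complex, and its product total complex
is a pure injective resolution when the complex resolved is bounded below: in each degree,
exactness is reached after finitely many dimension shifts. Given a resolution `I` of the `n`-th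
truncation, a morphism from a resolution `K` of the next one to `I` exists up to homotopy; adding
the path complex of `I` to `K` makes it strictly compatible and degreewise split surjective. Along
the resulting tower a Mittag-Leffler argument applies to the Hom complexes, so that
`K`-pure injectivity passes to the limit. It also applies to the mapping cones of the resolutions,
as the truncations of `M` are eventually constant in each degree.
-/

namespace PureRes

open TensorProduct CochainComplex CochainComplex.HomComplex

variable {R : Type u} [CommRing R]

section Purity

variable {A B C : Type u} [AddCommGroup A] [AddCommGroup B] [AddCommGroup C]
  [Module R A] [Module R B] [Module R C]

/-- Pure monomorphisms of modules: those which stay injective after tensoring with any module. -/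
def IsPureMono (f : A →ₗ[R] B) : Prop :=
  ∀ (N : Type u) [AddCommGroup N] [Module R N], Function.Injective (f.lTensor N)

/-- Pure epimorphisms of modules: those through which every linear map from a finitely presented
module factors. -/
def IsPureEpi (g : B →ₗ[R] C) : Prop :=
  ∀ (P : Type u) [AddCommGroup P] [Module R P] [Module.FinitePresentation R P]
    (x : P →ₗ[R] C), ∃ y : P →ₗ[R] B, g ∘ₗ y = x

lemma IsPureEpi.surjective {g : B →ₗ[R] C} (hg : IsPureEpi g) : Function.Surjective g := by
  intro c
  obtain ⟨y, hy⟩ := hg R (LinearMap.toSpanSingleton R C c)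
  exact ⟨y 1, by simpa using LinearMap.congr_fun hy 1⟩

lemma exists_sum_tmul_of_span_eq_top {ι : Type*} [Fintype ι] {s : ι → A}
    (hs : Submodule.span R (Set.range s) = ⊤) (z : A ⊗[R] B) :
    ∃ x : ι → B, z = ∑ i, s i ⊗ₜ[R] x i := by
  induction z with
  | zero => exact ⟨0, by simp⟩
  | add z z' h h' =>
    obtain ⟨x, rfl⟩ := h
    obtain ⟨x', rfl⟩ := h'
    exact ⟨x + x', by simp [tmul_add, Finset.sum_add_distrib]⟩
  | tmul a b =>
    obtain ⟨c, rfl⟩ :=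
      (Submodule.mem_span_range_iff_exists_fun R).1 (hs ▸ Submodule.mem_top : a ∈ _)
    exact ⟨fun i ↦ c i • b, by simp [sum_tmul, smul_tmul]⟩

lemma exists_fg_lTensor_eq_zero {f : A →ₗ[R] B} {N : Type u} [AddCommGroup N] [Module R N]
    {z : N ⊗[R] A} (hz : f.lTensor N z = 0) :
    ∃ (Q : Submodule R N) (_ : Q.FG) (t : Q ⊗[R] A), Q.subtype.rTensor A t = z ∧
      f.lTensor Q t = 0 := by
  obtain ⟨N', hN', t, rfl⟩ := Submodule.exists_fg_le_eq_rTensor_subtype z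
  obtain ⟨Q, hQ, hQfg, h0⟩ := TensorProduct.eq_zero_of_fg_of_subtype_eq_zero hN'
    (t := f.lTensor N' t) (by
      rw [← hz, ← LinearMap.comp_apply, ← LinearMap.comp_apply, LinearMap.rTensor_comp_lTensor,
        LinearMap.lTensor_comp_rTensor])
  refine ⟨Q, hQfg, (Submodule.inclusion hQ).rTensor A t, ?_, ?_⟩
  · rw [← LinearMap.comp_apply, ← LinearMap.rTensor_comp, Submodule.subtype_comp_inclusion]
  · rw [← h0, ← LinearMap.comp_apply, ← LinearMap.comp_apply, LinearMap.rTensor_comp_lTensor,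
      LinearMap.lTensor_comp_rTensor]

/-- Tensoring with the cokernel of the transpose of `a` detects the solvability of linear systems
with matrix `a`. -/
lemma IsPureMono.exists_solution {f : A →ₗ[R] B} (hf : IsPureMono f) {r k : ℕ}
    (a : Fin r → Fin k → R) (α : Fin r → A) (b : Fin k → B)
    (hb : ∀ i, ∑ j, a i j • b j = f (α i)) : ∃ w : Fin k → A, ∀ i, ∑ j, a i j • w j = α i := by
  let S : Submodule R (Fin r → R) := Submodule.span R (Set.range fun j i ↦ a i j)
  let e (i : Fin r) : (Fin r → R) ⧸ S := S.mkQ (Pi.single i 1)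
  have hsum (c : Fin r → R) : ∑ i, c i • e i = S.mkQ c := by
    simp only [e, ← map_smul, ← map_sum, ← pi_eq_sum_univ']
  have hspan : Submodule.span R (Set.range e) = ⊤ := by
    refine eq_top_iff.2 fun q _ ↦ ?_
    obtain ⟨c, rfl⟩ := S.mkQ_surjective q
    exact (Submodule.mem_span_range_iff_exists_fun R).2 ⟨c, hsum c⟩
  have hcol (j : Fin k) : ∑ i, a i j • e i = 0 := by
    rw [hsum fun i ↦ a i j]
    exact (Submodule.Quotient.mk_eq_zero S).2 (Submodule.subset_span ⟨j, rfl⟩)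
  have hzero : ∑ i, e i ⊗ₜ[R] α i = 0 := by
    apply hf
    rw [map_zero, map_sum]
    exact sum_tmul_eq_zero_of_vanishesTrivially R ⟨k, a, b, fun i ↦ (hb i).symm, hcol⟩
  obtain ⟨s, c, y, hy, hc⟩ := vanishesTrivially_of_sum_tmul_eq_zero R hspan hzero
  have hcS (l : Fin s) : ∃ t : Fin k → R, ∑ j, t j • (fun i ↦ a i j) = fun i ↦ c i l :=
    (Submodule.mem_span_range_iff_exists_fun R).1
      ((Submodule.Quotient.mk_eq_zero S).1 ((hsum fun i ↦ c i l).symm.trans (hc l)))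
  choose t ht using hcS
  refine ⟨fun j ↦ ∑ l, t l j • y l, fun i ↦ ?_⟩
  have hct (l : Fin s) : ∑ j, a i j * t l j = c i l := by
    simpa [mul_comm] using congr_fun (ht l) i
  simp only [hy, ← hct, Finset.smul_sum, Finset.sum_smul, smul_smul]
  exact Finset.sum_comm

lemma isPureMono_of_exists_solution {f : A →ₗ[R] B} (hf : ∀ {r k : ℕ} (a : Fin r → Fin k → R)
    (α : Fin r → A) (b : Fin k → B), (∀ i, ∑ j, a i j • b j = f (α i)) →
      ∃ w : Fin k → A, ∀ i, ∑ j, a i j • w j = α i) : IsPureMono f := by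
  intro N _ _
  rw [injective_iff_map_eq_zero]
  intro z hz
  obtain ⟨Q, hQ, t, rfl, ht⟩ := exists_fg_lTensor_eq_zero hz
  obtain ⟨r, s, hs⟩ := Module.Finite.iff_fg.2 hQ |>.exists_fin
  obtain ⟨α, rfl⟩ := exists_sum_tmul_of_span_eq_top hs t
  simp only [map_sum, LinearMap.lTensor_tmul] at ht
  obtain ⟨k, a, b, hb, ha⟩ := vanishesTrivially_of_sum_tmul_eq_zero R hs ht
  obtain ⟨w, hw⟩ := hf a α b fun i ↦ (hb i).symm
  rw [sum_tmul_eq_zero_of_vanishesTrivially R ⟨k, a, w, fun i ↦ (hw i).symm, ha⟩, map_zero]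

lemma span_le_ker_linearCombination {r k : ℕ} {a : Fin r → Fin k → R} {b : Fin k → B}
    (hab : ∀ i, ∑ j, a i j • b j = 0) :
    Submodule.span R (Set.range a) ≤ LinearMap.ker (Fintype.linearCombination R b) := by
  rw [Submodule.span_le]
  rintro _ ⟨i, rfl⟩
  simpa only [SetLike.mem_coe, LinearMap.mem_ker, Fintype.linearCombination_apply] using hab i

/-- Solutions of the system with matrix `a` are linear maps out of the cokernel of `a`. -/
lemma IsPureEpi.exists_solution {g : B →ₗ[R] C} (hg : IsPureEpi g) {r k : ℕ}
    (a : Fin r → Fin k → R) (c : Fin k → C) (hc : ∀ i, ∑ j, a i j • c j = 0) :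
    ∃ b : Fin k → B, (∀ j, g (b j) = c j) ∧ ∀ i, ∑ j, a i j • b j = 0 := by
  let S : Submodule R (Fin k → R) := Submodule.span R (Set.range a)
  have : Module.FinitePresentation R ((Fin k → R) ⧸ S) :=
    Module.finitePresentation_of_surjective S.mkQ S.mkQ_surjective
      (by rw [S.ker_mkQ]; exact Submodule.fg_span (Set.finite_range a))
  obtain ⟨y, hy⟩ := hg _ (S.liftQ _ (span_le_ker_linearCombination hc))
  refine ⟨fun j ↦ y (S.mkQ (Pi.single j 1)), fun j ↦ ?_, fun i ↦ ?_⟩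
  · simpa [Fintype.linearCombination_apply, Pi.single_apply] using
      LinearMap.congr_fun hy (S.mkQ (Pi.single j 1))
  · simp only [← map_smul, ← map_sum, ← pi_eq_sum_univ']
    rw [S.mkQ_apply, (Submodule.Quotient.mk_eq_zero S).2 (Submodule.subset_span ⟨i, rfl⟩), map_zero]

lemma isPureEpi_of_exists_solution {g : B →ₗ[R] C} (hg : ∀ {r k : ℕ} (a : Fin r → Fin k → R)
    (c : Fin k → C), (∀ i, ∑ j, a i j • c j = 0) →
      ∃ b : Fin k → B, (∀ j, g (b j) = c j) ∧ ∀ i, ∑ j, a i j • b j = 0) : IsPureEpi g := by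
  intro P _ _ _ x
  obtain ⟨k, K, ε, hK⟩ := Module.FinitePresentation.exists_fin R P
  obtain ⟨r, a, rfl⟩ := Submodule.fg_iff_exists_fin_generating_family.1 hK
  let S : Submodule R (Fin k → R) := Submodule.span R (Set.range a)
  let q : (Fin k → R) →ₗ[R] P := ε.symm ∘ₗ S.mkQ
  have hq' : Function.Surjective q := ε.symm.surjective.comp S.mkQ_surjective
  have hq (i : Fin r) : q (a i) = 0 := by
    simp only [q, LinearMap.comp_apply, Submodule.mkQ_apply,
      (Submodule.Quotient.mk_eq_zero S).2 (Submodule.subset_span ⟨i, rfl⟩), map_zero]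
  obtain ⟨b, hb, hab⟩ := hg a (fun j ↦ x (q (Pi.single j 1))) fun i ↦ by
    simp only [← map_smul, ← map_sum, ← pi_eq_sum_univ', hq, map_zero]
  refine ⟨S.liftQ _ (span_le_ker_linearCombination hab) ∘ₗ ε, ?_⟩
  rw [← LinearMap.cancel_right hq']
  ext j
  simp [q, hb, Fintype.linearCombination_apply, Pi.single_apply]

lemma IsPureMono.isPureEpi {f : A →ₗ[R] B} {g : B →ₗ[R] C} (hf : IsPureMono f)
    (hg : Function.Surjective g) (hfg : Function.Exact f g) : IsPureEpi g := by
  refine isPureEpi_of_exists_solution fun a c hc ↦ ?_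
  choose b hb using fun j ↦ hg (c j)
  choose α hα using fun i ↦ (hfg (∑ j, a i j • b j)).1 (by simp [hb, hc])
  obtain ⟨w, hw⟩ := hf.exists_solution a α b fun i ↦ (hα i).symm
  refine ⟨fun j ↦ b j - f (w j), fun j ↦ by simp [hb, hfg.apply_apply_eq_zero], fun i ↦ ?_⟩
  simp only [smul_sub, Finset.sum_sub_distrib, ← hα, ← map_smul, ← map_sum, hw, sub_self]

lemma IsPureEpi.isPureMono_ker_subtype {g : B →ₗ[R] C} (hg : IsPureEpi g) :
    IsPureMono (LinearMap.ker g).subtype := by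
  refine isPureMono_of_exists_solution fun a α b hb ↦ ?_
  obtain ⟨b', hb', hab'⟩ := hg.exists_solution a (fun j ↦ g (b j)) fun i ↦ by
    simp only [← map_smul, ← map_sum, hb, Submodule.subtype_apply, LinearMap.map_coe_ker]
  refine ⟨fun j ↦ ⟨b j - b' j, by simp [hb']⟩, fun i ↦ Subtype.ext ?_⟩
  simpa [smul_sub, Finset.sum_sub_distrib, hab'] using hb i

/-- For a complex `X₁ ⟶ X₂ ⟶ X₃ ⟶ X₄` with cocycle modules `Z₂`, `Z₃`, the sequence
`N ⊗ X₁ ⟶ N ⊗ X₂ ⟶ N ⊗ Z₃ ⟶ 0` is exact and `N ⊗ Z₃ ⟶ N ⊗ X₃` is injective. -/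
lemma exact_lTensor_of_isPureMono_ker {X₁ X₂ X₃ X₄ : Type u} [AddCommGroup X₁] [AddCommGroup X₂]
    [AddCommGroup X₃] [AddCommGroup X₄] [Module R X₁] [Module R X₂] [Module R X₃] [Module R X₄]
    {d₁ : X₁ →ₗ[R] X₂} {d₂ : X₂ →ₗ[R] X₃} {d₃ : X₃ →ₗ[R] X₄} (h₁₂ : Function.Exact d₁ d₂)
    (h₂₃ : Function.Exact d₂ d₃) (h₃ : IsPureMono (LinearMap.ker d₃).subtype)
    (N : Type u) [AddCommGroup N] [Module R N] :
    Function.Exact (d₁.lTensor N) (d₂.lTensor N) := by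
  let e : X₂ →ₗ[R] LinearMap.ker d₃ := d₂.codRestrict _ h₂₃.apply_apply_eq_zero
  have he : Function.Surjective e := fun z ↦ by
    obtain ⟨x, hx⟩ := (h₂₃ z).1 z.2
    exact ⟨x, Subtype.ext hx⟩
  have hd : d₂.lTensor N = (LinearMap.ker d₃).subtype.lTensor N ∘ₗ e.lTensor N := by
    rw [← LinearMap.lTensor_comp]
    rfl
  have h₁e : Function.Exact d₁ e := fun x ↦ by
    rw [← h₁₂ x, ← Subtype.coe_inj]
    rfl
  intro z
  rw [hd, LinearMap.comp_apply, ← lTensor_exact N h₁e he z]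
  exact (injective_iff_map_eq_zero' _).1 (h₃ N) _

end Purity

section HomExactness

lemma acyclic_iff_forall (X : Cplx R) : X.Acyclic ↔ ∀ i j k : ℤ, i + 1 = j → j + 1 = k →
    ∀ x : X.X j, X.d j k x = 0 → ∃ y : X.X i, X.d i j y = x := by
  have exactAt_iff (i j k : ℤ) (hij : i + 1 = j) (hjk : j + 1 = k) :
      X.ExactAt j ↔ ∀ x : X.X j, X.d j k x = 0 → ∃ y : X.X i, X.d i j y = x := by
    rw [X.exactAt_iff' i j k (by simp; lia) (by simp; lia), ShortComplex.moduleCat_exact_iff]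
    rfl
  exact ⟨fun h i j k hij hjk ↦ (exactAt_iff i j k hij hjk).1 (h j),
    fun h j ↦ (exactAt_iff _ _ _ (sub_add_cancel j 1) rfl).2 (h _ _ _ (sub_add_cancel j 1) rfl)⟩

lemma isPureAcyclic_iff_forall (X : Cplx R) : IsPureAcyclic X ↔
    ∀ (N : ModuleCat.{u} R) (i j k : ℤ), i + 1 = j → j + 1 = k → ∀ z : N ⊗[R] X.X j,
      (X.d j k).hom.lTensor N z = 0 → ∃ y, (X.d i j).hom.lTensor N y = z :=
  forall_congr' fun _ ↦ acyclic_iff_forall _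

/-- Exactness in degree `j` of the complexes `Hom(P, X)`, for all finitely presented `P`. If it
holds in all degrees, then `X` is pure acyclic. -/
def IsHomExactAt (X : Cplx R) (j : ℤ) : Prop :=
  ∀ (P : ModuleCat.{u} R) [Module.FinitePresentation R P] (x : P ⟶ X.X j),
    x ≫ X.d j (j + 1) = 0 → ∃ y : P ⟶ X.X (j - 1), y ≫ X.d (j - 1) j = x

lemma isHomExactAt_iff {X : Cplx R} {i j k : ℤ} (hij : i + 1 = j) (hjk : j + 1 = k) :
    IsHomExactAt X j ↔ ∀ (P : ModuleCat.{u} R) [Module.FinitePresentation R P] (x : P ⟶ X.X j),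
      x ≫ X.d j k = 0 → ∃ y : P ⟶ X.X i, y ≫ X.d i j = x := by
  obtain rfl : i = j - 1 := by lia
  subst hjk
  rfl

lemma IsHomExactAt.isPureEpi_codRestrict {X : Cplx R} {i j k : ℤ} (hX : IsHomExactAt X j)
    (hij : i + 1 = j) (hjk : j + 1 = k) :
    IsPureEpi ((X.d i j).hom.codRestrict (LinearMap.ker (X.d j k).hom)
      fun x ↦ ConcreteCategory.congr_hom (X.d_comp_d i j k) x) := by
  intro P _ _ _ x
  obtain ⟨y, hy⟩ := (isHomExactAt_iff hij hjk).1 hX (ModuleCat.of R P)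
    (ModuleCat.ofHom ((Submodule.subtype _).comp x))
    (ModuleCat.hom_ext (LinearMap.ext fun p ↦ (x p).2))
  exact ⟨y.hom, LinearMap.ext fun p ↦ Subtype.ext (ConcreteCategory.congr_hom hy p :)⟩

lemma IsHomExactAt.exact {X : Cplx R} {i j k : ℤ} (hX : IsHomExactAt X j)
    (hij : i + 1 = j) (hjk : j + 1 = k) : Function.Exact (X.d i j).hom (X.d j k).hom := by
  refine fun z ↦ ⟨fun hz ↦ ?_, ?_⟩
  · obtain ⟨y, hy⟩ := (hX.isPureEpi_codRestrict hij hjk).surjective ⟨z, hz⟩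
    exact ⟨y, congr_arg Subtype.val hy⟩
  · rintro ⟨y, rfl⟩
    exact ConcreteCategory.congr_hom (X.d_comp_d i j k) y

lemma isPureMono_ker_d {X : Cplx R} {j k l : ℤ} (hX : IsHomExactAt X k)
    (hjk : j + 1 = k) (hkl : k + 1 = l) : IsPureMono (LinearMap.ker (X.d j k).hom).subtype := by
  rw [← LinearMap.ker_codRestrict]
  exact (hX.isPureEpi_codRestrict hjk hkl).isPureMono_ker_subtype

lemma isPureAcyclic_of_isHomExactAt {X : Cplx R} (hX : ∀ j, IsHomExactAt X j) :
    IsPureAcyclic X := by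
  rw [isPureAcyclic_iff_forall]
  intro N i j k hij hjk z hz
  exact (exact_lTensor_of_isPureMono_ker ((hX j).exact hij hjk) ((hX k).exact hjk rfl)
    (isPureMono_ker_d (hX (k + 1)) rfl rfl) N z).1 hz

lemma isHomExactAt_mappingCone_iff {M N : Cplx R} {f : M ⟶ N} {i j k l : ℤ} (hij : i + 1 = j)
    (hjk : j + 1 = k) (hkl : k + 1 = l) : IsHomExactAt (mappingCone f) j ↔
      ∀ (P : ModuleCat.{u} R) [Module.FinitePresentation R P] (x : P ⟶ M.X k) (y : P ⟶ N.X j),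
        x ≫ M.d k l = 0 → x ≫ f.f k + y ≫ N.d j k = 0 →
        ∃ (x' : P ⟶ M.X j) (y' : P ⟶ N.X i),
          x' ≫ M.d j k = -x ∧ x' ≫ f.f j + y' ≫ N.d i j = y := by
  rw [isHomExactAt_iff hij hjk]
  refine forall₂_congr fun P _ ↦ ⟨fun h x y hx hxy ↦ ?_, fun h z hz ↦ ?_⟩
  · obtain ⟨z, hz⟩ := h (x ≫ (mappingCone.inl f).v k j (by lia) + y ≫ (mappingCone.inr f).f j) (by
      apply mappingCone.ext_to f k l hkl
      · simp [mappingCone.d_fst_v _ _ _ _ hjk hkl, hx]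
      · simpa [mappingCone.d_snd_v _ _ _ hjk] using hxy)
    have hx' := hz =≫ (mappingCone.fst f).1.v j k hjk
    have hy' := hz =≫ (mappingCone.snd f).v j j (add_zero j)
    refine ⟨z ≫ (mappingCone.fst f).1.v i j hij, z ≫ (mappingCone.snd f).v i i (add_zero i),
      ?_, ?_⟩
    · simpa [mappingCone.d_fst_v _ _ _ _ hij hjk, neg_eq_iff_eq_neg] using hx'
    · simpa [mappingCone.d_snd_v _ _ _ hij] using hy'
  · have hx := hz =≫ (mappingCone.fst f).1.v k l hkl
    have hy := hz =≫ (mappingCone.snd f).v k k (add_zero k)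
    obtain ⟨x', y', h₁, h₂⟩ := h (z ≫ (mappingCone.fst f).1.v j k hjk)
      (z ≫ (mappingCone.snd f).v j j (add_zero j))
      (by simpa [mappingCone.d_fst_v _ _ _ _ hjk hkl] using hx)
      (by simpa [mappingCone.d_snd_v _ _ _ hjk] using hy)
    refine ⟨x' ≫ (mappingCone.inl f).v j i (by lia) + y' ≫ (mappingCone.inr f).f i, ?_⟩
    apply mappingCone.ext_to f j k hjk
    · simp [mappingCone.d_fst_v _ _ _ _ hij hjk, h₁]
    · simp [mappingCone.d_snd_v _ _ _ hij, h₂]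

end HomExactness

section PureInjectivity

lemma IsPureAcyclic.tensorCplx {A : Cplx R} (hA : IsPureAcyclic A) (N : ModuleCat.{u} R) :
    IsPureAcyclic (tensorCplx N A) := by
  rw [isPureAcyclic_iff_forall] at hA ⊢
  intro N' i j k hij hjk z hz
  have assoc_symm_d (a b : ℤ) (t : N' ⊗[R] (N ⊗[R] A.X a)) :
      (A.d a b).hom.lTensor (N' ⊗[R] N) ((TensorProduct.assoc R N' N (A.X a)).symm t) =
        (TensorProduct.assoc R N' N (A.X b)).symm (((A.d a b).hom.lTensor N).lTensor N' t) := by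
    rw [LinearMap.lTensor_tensor]
    simp
  obtain ⟨y, hy⟩ := hA (ModuleCat.of R (N' ⊗[R] N)) i j k hij hjk
    ((TensorProduct.assoc R N' N (A.X j)).symm z)
    ((assoc_symm_d j k z).trans ((congr_arg _ hz).trans (map_zero _)))
  refine ⟨TensorProduct.assoc R N' N (A.X i) y,
    (TensorProduct.assoc R N' N (A.X j)).symm.injective ((assoc_symm_d i j _).symm.trans ?_)⟩
  rw [LinearEquiv.symm_apply_apply]
  exact hy

lemma IsPureAcyclic.acyclic {A : Cplx R} (hA : IsPureAcyclic A) : A.Acyclic := by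
  rw [isPureAcyclic_iff_forall] at hA
  refine (acyclic_iff_forall A).2 fun i j k hij hjk x hx ↦ ?_
  have lid_d (a b : ℤ) (t : R ⊗[R] A.X a) : TensorProduct.lid R (A.X b)
      ((A.d a b).hom.lTensor R t) = A.d a b (TensorProduct.lid R (A.X a) t) := by
    induction t with
    | zero => simp
    | add t t' h h' => simp only [map_add, h, h']
    | tmul r a => simp
  obtain ⟨y, hy⟩ := hA (ModuleCat.of R R) i j k hij hjk (1 ⊗ₜ x)
    ((LinearMap.lTensor_tmul ..).trans ((congr_arg _ hx).trans (tmul_zero _ _)))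
  refine ⟨TensorProduct.lid R (A.X i) y, ?_⟩
  rw [← lid_d]
  exact (congr_arg _ hy).trans (by simp)

lemma δ_v_apply {A I : Cplx R} {n k : ℤ} (hnk : n + 1 = k) (z : Cochain A I n) (p q q₁ q₂ : ℤ)
    (hpq : p + k = q) (hq₁ : p + n = q₁) (hq₂ : p + 1 = q₂) (a : A.X p) :
    (δ n k z).v p q hpq a = I.d q₁ q (z.v p q₁ hq₁ a) +
      k.negOnePow • z.v q₂ q (by lia) (A.d p q₂ a) := by
  rw [δ_v n k hnk z p q hpq q₁ q₂ (by lia) hq₂]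
  simp

/-- The direction `Hom(P, Hom(A, I)) → Hom(P ⊗ A, I)` of the tensor-Hom adjunction, for cochains. -/
noncomputable def cochainUncurry {P : ModuleCat.{u} R} {A I : Cplx R} {n : ℤ}
    (X : P →ₗ[R] Cochain A I n) : Cochain (tensorCplx P A) I n :=
  Cochain.mk fun p q hpq ↦ ModuleCat.ofHom (TensorProduct.lift
    { toFun := fun t ↦ ((X t).v p q hpq).hom
      map_add' := fun s t ↦ by rw [map_add]; rfl
      map_smul' := fun r t ↦ by rw [map_smul]; rfl })

/-- The direction `Hom(P ⊗ A, I) → Hom(P, Hom(A, I))` of the tensor-Hom adjunction, for cochains. -/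
noncomputable def cochainCurry {P : ModuleCat.{u} R} {A I : Cplx R} {n : ℤ}
    (α : Cochain (tensorCplx P A) I n) : P →ₗ[R] Cochain A I n where
  toFun t := Cochain.mk fun p q hpq ↦ ModuleCat.ofHom
    ((α.v p q hpq).hom ∘ₗ TensorProduct.mk R P (A.X p) t)
  map_add' s t := by
    refine Cochain.ext _ _ fun p q hpq ↦ ModuleCat.hom_ext (LinearMap.ext fun a ↦ ?_)
    exact (congr_arg _ (TensorProduct.add_tmul s t a)).trans
      (map_add (α.v p q hpq).hom (s ⊗ₜ[R] a) (t ⊗ₜ[R] a))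
  map_smul' r t := by
    refine Cochain.ext _ _ fun p q hpq ↦ ModuleCat.hom_ext (LinearMap.ext fun a ↦ ?_)
    exact map_smul (α.v p q hpq).hom r (t ⊗ₜ[R] a)

lemma δ_cochainUncurry_eq_zero {P : ModuleCat.{u} R} {A I : Cplx R} {n k : ℤ} (hnk : n + 1 = k)
    {X : P →ₗ[R] Cochain A I n} (hX : ∀ t, δ n k (X t) = 0) : δ n k (cochainUncurry X) = 0 := by
  refine Cochain.ext _ _ fun p q hpq ↦ ModuleCat.hom_ext (TensorProduct.ext' fun t a ↦ ?_)
  exact (δ_v_apply hnk (cochainUncurry X) p q _ _ hpq rfl rfl _).trans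
    ((δ_v_apply hnk (X t) p q _ _ hpq rfl rfl a).symm.trans
      (ConcreteCategory.congr_hom (Cochain.congr_v (hX t) p q hpq) a))

lemma δ_cochainCurry {P : ModuleCat.{u} R} {A I : Cplx R} {m n : ℤ} (hmn : m + 1 = n)
    {α : Cochain (tensorCplx P A) I m} {X : P →ₗ[R] Cochain A I n}
    (hα : δ m n α = cochainUncurry X) (t : P) : δ m n (cochainCurry α t) = X t := by
  refine Cochain.ext _ _ fun p q hpq ↦ ModuleCat.hom_ext (LinearMap.ext fun a ↦ ?_)
  exact (δ_v_apply hmn (cochainCurry α t) p q _ _ hpq rfl rfl a).trans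
    ((δ_v_apply hmn α p q _ _ hpq rfl rfl _).symm.trans
      (ConcreteCategory.congr_hom (Cochain.congr_v hα p q hpq) (t ⊗ₜ[R] a)))

lemma isKPureInjective_iff (I : Cplx R) : IsKPureInjective I ↔
    ∀ A : Cplx R, IsPureAcyclic A → ∀ m n k : ℤ, m + 1 = n → n + 1 = k →
      ∀ z : Cochain A I n, δ n k z = 0 → ∃ α : Cochain A I m, δ m n α = z := by
  refine ⟨fun hI A hA ↦ (acyclic_iff_forall _).1 (hI A hA).acyclic, fun hI A hA ↦
    isPureAcyclic_of_isHomExactAt fun n ↦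
      (isHomExactAt_iff (sub_add_cancel n 1) rfl).2 fun P _ x hx ↦ ?_⟩
  let X : P →ₗ[R] Cochain A I n := x.hom
  obtain ⟨α, hα⟩ := hI _ (hA.tensorCplx P) _ _ _ (sub_add_cancel n 1) rfl (cochainUncurry X)
    (δ_cochainUncurry_eq_zero rfl fun t ↦ ConcreteCategory.congr_hom hx t)
  exact ⟨ModuleCat.ofHom (Y := Cochain A I (n - 1)) (cochainCurry α),
    ModuleCat.hom_ext (LinearMap.ext (δ_cochainCurry (sub_add_cancel n 1) hα))⟩

lemma isPureInjective_iff (E : ModuleCat.{u} R) : IsPureInjective E ↔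
    ∀ A : Cplx R, IsPureAcyclic A → ∀ i j k : ℤ, i + 1 = j → j + 1 = k →
      ∀ φ : A.X j ⟶ E, A.d i j ≫ φ = 0 → ∃ ψ : A.X k ⟶ E, A.d j k ≫ ψ = φ := by
  refine (isKPureInjective_iff _).trans
    ⟨fun hE A hA i j k hij hjk φ hφ ↦ ?_, fun hE A hA m n k hmn hnk z hz ↦ ?_⟩
  · obtain ⟨α, hα⟩ := hE A hA (-k) (-j) (-i) (by lia) (by lia)
      (Cochain.toSingleMk φ (add_neg_cancel j))
      (by rw [Cochain.δ_toSingleMk _ _ _ i (by lia), hφ, Cochain.toSingleMk_zero, smul_zero])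
    obtain ⟨ψ, rfl⟩ := Cochain.toSingleMk_surjective α k (add_neg_cancel k)
    rw [Cochain.δ_toSingleMk _ _ _ j (add_neg_cancel j)] at hα
    refine ⟨(-j).negOnePow • ψ, ?_⟩
    simpa [Units.smul_def] using congr_arg (Cochain.toSingleEquiv (add_neg_cancel j)) hα
  · obtain ⟨φ, rfl⟩ := Cochain.toSingleMk_surjective z (-n) (neg_add_cancel n)
    rw [Cochain.δ_toSingleMk _ _ _ (-k) (by lia)] at hz
    obtain ⟨ψ, rfl⟩ := hE A hA (-k) (-n) (-m) (by lia) (by lia) φ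
      (by simpa [Units.smul_def] using congr_arg (Cochain.toSingleEquiv (neg_add_cancel k)) hz)
    refine ⟨n.negOnePow • Cochain.toSingleMk ψ (neg_add_cancel m), ?_⟩
    rw [δ_units_smul, Cochain.δ_toSingleMk _ _ _ (-n) (neg_add_cancel n), smul_smul]
    simp

end PureInjectivity

section PureInjectives

lemma IsPureInjective.of_id_eq_add {E E₁ E₂ : ModuleCat.{u} R} (h₁ : IsPureInjective E₁)
    (h₂ : IsPureInjective E₂) {p₁ : E ⟶ E₁} {i₁ : E₁ ⟶ E} {p₂ : E ⟶ E₂} {i₂ : E₂ ⟶ E}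
    (h : p₁ ≫ i₁ + p₂ ≫ i₂ = 𝟙 E) : IsPureInjective E := by
  rw [isPureInjective_iff] at h₁ h₂ ⊢
  intro A hA i j k hij hjk φ hφ
  obtain ⟨ψ₁, hψ₁⟩ := h₁ A hA i j k hij hjk (φ ≫ p₁) (by rw [reassoc_of% hφ, zero_comp])
  obtain ⟨ψ₂, hψ₂⟩ := h₂ A hA i j k hij hjk (φ ≫ p₂) (by rw [reassoc_of% hφ, zero_comp])
  refine ⟨ψ₁ ≫ i₁ + ψ₂ ≫ i₂, ?_⟩
  rw [Preadditive.comp_add, reassoc_of% hψ₁, reassoc_of% hψ₂, ← Preadditive.comp_add, h,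
    Category.comp_id]

lemma IsPureInjective.of_retract {E E' : ModuleCat.{u} R} (hE : IsPureInjective E) {i : E' ⟶ E}
    {r : E ⟶ E'} (h : i ≫ r = 𝟙 E') : IsPureInjective E' :=
  hE.of_id_eq_add hE (p₁ := i) (i₁ := r) (p₂ := 0) (i₂ := 0) (by simpa using h)

lemma isPureInjective_pi {ι : Type} {E : ι → ModuleCat.{u} R} (hE : ∀ i, IsPureInjective (E i)) :
    IsPureInjective (∏ᶜ E) := by
  simp only [isPureInjective_iff] at hE ⊢
  intro A hA a b c hab hbc φ hφ
  choose ψ hψ using fun i ↦ hE i A hA a b c hab hbc (φ ≫ Pi.π E i)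
    (by rw [reassoc_of% hφ, zero_comp])
  exact ⟨Pi.lift ψ, Pi.hom_ext _ _ fun i ↦ by rw [Category.assoc, Pi.lift_π, hψ]⟩

/-- The inductive step in the construction of a primitive of `z`: if `δ α` agrees with `z` up to
degree `p`, then it can be made to agree up to degree `p + 1` by changing `α` in degree `p + 2`. -/
lemma exists_single_eqUpTo {K L : Cplx R} (hK : IsPureAcyclic K)
    (hL : ∀ i, IsPureInjective (L.X i)) {m n k : ℤ} (hmn : m + 1 = n) (hnk : n + 1 = k)
    {z : Cochain K L n} (hz : δ n k z = 0) {α : Cochain K L m} (p p' : ℤ) (hp : p + 1 = p')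
    (hα : (δ m n α).EqUpTo z p) :
    ∃ h : K.X (p' + 1) ⟶ L.X (p' + n), (δ m n (α + Cochain.single h m)).EqUpTo z p' := by
  subst hp hmn
  let u := (z - δ m (m + 1) α).v (p + 1) (p + 1 + (m + 1)) rfl
  have hu : K.d p (p + 1) ≫ u = 0 := by
    have e := Cochain.congr_v (show δ (m + 1) k (z - δ m (m + 1) α) = 0 by simp [hz, δ_δ])
      p (p + 1 + (m + 1)) (by lia)
    rw [δ_v _ _ hnk _ _ _ _ (p + 1 + m) (p + 1) (by lia) rfl, Cochain.sub_v,
      hα p (p + 1 + m) (by lia) le_rfl, sub_self, zero_comp, zero_add, Cochain.zero_v] at e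
    exact (smul_eq_zero_iff_eq _).1 e
  obtain ⟨β, hβ⟩ := (isPureInjective_iff _).1 (hL _) K hK _ _ _ rfl rfl u hu
  refine ⟨(m + 1).negOnePow • β, fun q r hqr hq ↦ ?_⟩
  rw [δ_add, Cochain.add_v, δ_v _ _ rfl (Cochain.single _ m) q r hqr (q + m) (q + 1) (by lia) rfl,
    Cochain.single_v_eq_zero _ _ _ _ _ (by lia), zero_comp, zero_add]
  obtain hq | rfl := hq.lt_or_eq
  · rw [hα q r hqr (by lia), Cochain.single_v_eq_zero _ _ _ _ _ (by lia), comp_zero, smul_zero,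
      add_zero]
  · obtain rfl := hqr
    simp [hβ, u, smul_smul]

open Cochain.InductionUp in
lemma IsBoundedBelow.isKPureInjective {L : Cplx R} (hL : IsBoundedBelow L)
    (hL' : ∀ i, IsPureInjective (L.X i)) : IsKPureInjective L := by
  refine (isKPureInjective_iff L).2 fun K hK m n k hmn hnk z hz ↦ ?_
  obtain ⟨d, hd⟩ := hL
  let X (i : ℕ) : Set (Cochain K L m) := {α | (δ m n α).EqUpTo z (i + d - n - 1)}
  let x₀ : X 0 := ⟨0, fun p q hpq hp ↦ (hd _ (by lia)).eq_of_tgt _ _⟩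
  let φ (i : ℕ) (α : X i) : X (i + 1) :=
    ⟨_, (exists_single_eqUpTo hK hL' hmn hnk hz (i + d - n - 1) ((i + 1 : ℕ) + d - n - 1)
      (by lia) α.2).choose_spec⟩
  have hφ (i : ℕ) (x : X i) : (φ i x).1.EqUpTo x.1 (d - n + i) := fun p q hpq hp ↦ by
    dsimp only [φ]
    rw [Cochain.add_v, add_eq_left, Cochain.single_v_eq_zero _ _ _ _ _ (by lia)]
  refine ⟨limitSequence φ hφ x₀, Cochain.ext _ _ fun p q hpq ↦ ?_⟩
  let k₀ := (p - d + n + 1).toNat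
  rw [← (sequence φ x₀ k₀).2 p q hpq (by lia), δ_v _ _ hmn _ p q hpq (q - 1) (p + 1) rfl rfl,
    δ_v _ _ hmn _ p q hpq (q - 1) (p + 1) rfl rfl,
    limitSequence_eqUpTo φ hφ x₀ k₀ p (q - 1) (by lia) (by lia),
    limitSequence_eqUpTo φ hφ x₀ k₀ (p + 1) q (by lia) (by lia)]

end PureInjectives

section DoubleCharacter

lemma exists_character_comp_eq {B C : Type u} [AddCommGroup B] [AddCommGroup C] (f : B →+ C)
    (χ : CharacterModule B) (h : ∀ b, f b = 0 → χ b = 0) :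
    ∃ ψ : CharacterModule C, ∀ b, ψ (f b) = χ b := by
  let χ' : CharacterModule f.range := f.rangeRestrict.liftOfSurjective f.rangeRestrict_surjective
    ⟨χ, fun b hb ↦ h b (congr_arg Subtype.val hb)⟩
  obtain ⟨ψ, hψ⟩ := CharacterModule.dual_surjective_of_injective (R := ℤ)
    f.range.subtype.toIntLinearMap f.range.subtype_injective χ'
  refine ⟨ψ, fun b ↦ (DFunLike.congr_fun hψ (f.rangeRestrict b)).trans ?_⟩
  exact AddMonoidHom.liftOfRightInverse_comp_apply f.rangeRestrict _ _
    ⟨(χ : B →+ _), fun b hb ↦ h b (congr_arg Subtype.val hb)⟩ b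

lemma isPureInjective_characterModule (X : Type u) [AddCommGroup X] [Module R X] :
    IsPureInjective (ModuleCat.of R (CharacterModule X)) := by
  refine (isPureInjective_iff _).2 fun A hA i j k hij hjk φ hφ ↦ ?_
  rw [isPureAcyclic_iff_forall] at hA
  let χ : CharacterModule (X ⊗[R] A.X j) := CharacterModule.homEquiv (R := R) φ.hom |>.comp
    (TensorProduct.comm R X (A.X j)).toAddMonoidHom
  obtain ⟨ψ, hψ⟩ := exists_character_comp_eq ((A.d j k).hom.lTensor X).toAddMonoidHom χ (by
    intro b hb
    obtain ⟨y, rfl⟩ := hA (ModuleCat.of R X) i j k hij hjk b hb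
    clear hb
    induction y with
    | zero => simp
    | add y y' h h' => rw [map_add, map_add, h, h', add_zero]
    | tmul x a => exact DFunLike.congr_fun (ConcreteCategory.congr_hom hφ a) x)
  refine ⟨ModuleCat.ofHom (CharacterModule.curry (R := R)
    (ψ.comp (TensorProduct.comm R (A.X k) X).toAddMonoidHom)), ?_⟩
  refine ModuleCat.hom_ext (LinearMap.ext fun a ↦ CharacterModule.ext _ fun x ↦ ?_)
  exact hψ (x ⊗ₜ a)

/-- The evaluation map of a module into its double character module. -/
def characterEval (M : Type u) [AddCommGroup M] [Module R M] :
    M →ₗ[R] CharacterModule (CharacterModule M) where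
  toFun m := AddMonoidHom.mk' (fun c ↦ c m) fun _ _ ↦ rfl
  map_add' m m' := CharacterModule.ext _ fun c ↦ map_add c m m'
  map_smul' _ _ := rfl

/-- After tensoring with `N`, each character of `N ⊗ M` still extends along the evaluation map:
view it as a map from `N` to the character module of `M`, and dualize twice. -/
lemma isPureMono_characterEval (M : Type u) [AddCommGroup M] [Module R M] :
    IsPureMono (characterEval (R := R) M) := by
  intro N _ _
  rw [injective_iff_map_eq_zero]
  intro z hz
  refine CharacterModule.eq_zero_of_character_apply fun χ ↦ ?_
  let χ' : CharacterModule (N ⊗[R] CharacterModule (CharacterModule M)) :=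
    CharacterModule.uncurry (R := R)
      (characterEval (CharacterModule M) ∘ₗ CharacterModule.curry (R := R) χ)
  have hχ' (t) : χ' ((characterEval M).lTensor N t) = χ t := by
    induction t with
    | zero => simp
    | add t t' h h' => rw [map_add, map_add, h, h', map_add]
    | tmul n m => rfl
  rw [← hχ', hz, map_zero]

variable (R) in
/-- The functor sending a module to its double character module. -/
def doubleCharacter : ModuleCat.{u} R ⥤ ModuleCat.{u} R where
  obj M := ModuleCat.of R (CharacterModule (CharacterModule M))
  map f := ModuleCat.ofHom (CharacterModule.dual (CharacterModule.dual f.hom))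

instance : (doubleCharacter R).Additive where
  map_add {M N f g} := by
    refine ModuleCat.hom_ext (LinearMap.ext fun (c : CharacterModule (CharacterModule M)) ↦
      CharacterModule.ext _ fun d ↦ ?_)
    refine Eq.trans ?_ (map_add c _ _)
    exact congr_arg c (CharacterModule.ext _ fun m ↦ map_add d _ _)

variable (R) in
/-- The evaluation maps into the double character modules, as a natural transformation. -/
def toDoubleCharacter : 𝟭 (ModuleCat.{u} R) ⟶ doubleCharacter R where
  app M := ModuleCat.ofHom (characterEval M)

end DoubleCharacter

section Cosyzygies

lemma v_comp_d {A B : Cplx R} (z : Cocycle A B 1) {p q r : ℤ} (hpq : p + 1 = q)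
    (hqr : q + 1 = r) : z.1.v p q hpq ≫ B.d q r = -(A.d p q ≫ z.1.v q r hqr) := by
  have := Cochain.congr_v (z.δ_eq_zero 2) p r (by lia)
  rw [δ_v 1 2 rfl z.1 p r (by lia) q q (by lia) (by lia)] at this
  simpa [add_eq_zero_iff_eq_neg, Int.negOnePow_even 2 (by decide)] using this

/-- The complex of double character modules of the terms of a complex. -/
noncomputable def envelope (F : Cplx R) : Cplx R :=
  ((doubleCharacter R).mapHomologicalComplex (ComplexShape.up ℤ)).obj F

/-- The termwise pure embedding of a complex into its `envelope`. -/
noncomputable def toEnvelope (F : Cplx R) : F ⟶ envelope F where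
  f i := (toDoubleCharacter R).app (F.X i)
  comm' i j _ := ((toDoubleCharacter R).naturality (F.d i j)).symm

lemma isPureMono_toEnvelope_f (F : Cplx R) (i : ℤ) : IsPureMono ((toEnvelope F).f i).hom :=
  isPureMono_characterEval (F.X i)

instance (F : Cplx R) (i : ℤ) : Mono ((toEnvelope F).f i) := by
  refine (ModuleCat.mono_iff_injective _).2 ((injective_iff_map_eq_zero _).2 fun m hm ↦ ?_)
  exact CharacterModule.eq_zero_of_character_apply (DFunLike.congr_fun (F := CharacterModule _) hm)

lemma isPureInjective_envelope (F : Cplx R) (i : ℤ) : IsPureInjective ((envelope F).X i) :=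
  isPureInjective_characterModule _

lemma isZero_envelope {F : Cplx R} {i : ℤ} (hF : IsZero (F.X i)) : IsZero ((envelope F).X i) :=
  (doubleCharacter R).map_isZero hF

/-- The cokernel of `toEnvelope F`, shifted so that its degrees start one above those of `F`. -/
noncomputable abbrev cosyzygy (F : Cplx R) : Cplx R :=
  (cokernel (toEnvelope F))⟦(-1 : ℤ)⟧

/-- The projection onto the cokernel of `toEnvelope F`, as a cocycle of degree one. -/
noncomputable def toCosyzygy (F : Cplx R) : Cocycle (envelope F) (cosyzygy F) 1 :=
  (Cocycle.ofHom (cokernel.π (toEnvelope F))).rightShift (-1) 1 (by simp)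

variable (F : Cplx R) {p q : ℤ} (hpq : p + 1 = q)

lemma toCosyzygy_v : (toCosyzygy F).1.v p q hpq = (cokernel.π (toEnvelope F)).f p ≫
    ((cokernel (toEnvelope F)).shiftFunctorObjXIso (-1) q p (by lia)).inv := by
  rw [toCosyzygy, Cocycle.rightShift_coe, Cochain.rightShift_v _ _ _ _ p q hpq p (by lia),
    Cocycle.ofHom_coe, Cochain.ofHom_v]

lemma toEnvelope_comp_toCosyzygy : (toEnvelope F).f p ≫ (toCosyzygy F).1.v p q hpq = 0 := by
  rw [toCosyzygy_v, ← Category.assoc, ← HomologicalComplex.comp_f, cokernel.condition,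
    HomologicalComplex.zero_f, zero_comp]

instance : Epi ((toCosyzygy F).1.v p q hpq) := by
  rw [toCosyzygy_v]
  exact epi_comp _ _

lemma exact_toCosyzygy : (ShortComplex.mk _ _ (toEnvelope_comp_toCosyzygy F hpq)).Exact := by
  let eval := HomologicalComplex.eval (ModuleCat.{u} R) (ComplexShape.up ℤ) p
  let S := ShortComplex.mk _ _ (cokernel.condition (toEnvelope F))
  let e : S.map eval ≅ ShortComplex.mk _ _ (toEnvelope_comp_toCosyzygy F hpq) :=
    ShortComplex.isoMk (Iso.refl (F.X p)) (Iso.refl ((envelope F).X p))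
      ((cokernel (toEnvelope F)).shiftFunctorObjXIso (-1) q p (by lia)).symm
      ((Category.id_comp _).trans (Category.comp_id _).symm)
      ((Category.id_comp _).trans (toCosyzygy_v F hpq))
  exact (ShortComplex.exact_iff_of_iso e).1 ((ShortComplex.exact_cokernel (toEnvelope F)).map eval)

lemma isPureEpi_toCosyzygy : IsPureEpi ((toCosyzygy F).1.v p q hpq).hom :=
  (isPureMono_toEnvelope_f F p).isPureEpi
    ((ModuleCat.epi_iff_surjective _).1 inferInstance)
    ((ShortComplex.ShortExact.moduleCat_exact_iff_function_exact _).1 (exact_toCosyzygy F hpq))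

end Cosyzygies

lemma isZero_cosyzygy {F : Cplx R} {p q : ℤ} (hpq : p + 1 = q) (hF : IsZero (F.X p)) :
    IsZero ((cosyzygy F).X q) :=
  IsZero.of_epi ((toCosyzygy F).1.v p q hpq) (isZero_envelope hF)

section Total

/-- A sequence of complexes and of cocycles of degree one between them, whose consecutive
composites vanish; in other words, a double complex with columns `X n`. -/
structure CocycleSequence (R : Type u) [CommRing R] where
  X : ℕ → Cplx R
  θ (n : ℕ) : Cocycle (X n) (X (n + 1)) 1
  θ_comp_θ (n : ℕ) {p q r : ℤ} (hpq : p + 1 = q) (hqr : q + 1 = r) :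
    (θ n).1.v p q hpq ≫ (θ (n + 1)).1.v q r hqr = 0

namespace CocycleSequence

variable (S : CocycleSequence R)

/-- The components of the differential of the total complex. -/
noncomputable def dComponent (p q : ℤ) (hpq : p + 1 = q) :
    ∀ n : ℕ, (∏ᶜ fun n ↦ (S.X n).X p) ⟶ (S.X n).X q
  | 0 => Pi.π _ 0 ≫ (S.X 0).d p q
  | n + 1 => Pi.π _ (n + 1) ≫ (S.X (n + 1)).d p q + Pi.π _ n ≫ (S.θ n).1.v p q hpq

lemma dComponent_succ {p q : ℤ} (hpq : p + 1 = q) (n : ℕ) : S.dComponent p q hpq (n + 1) =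
    Pi.π _ (n + 1) ≫ (S.X (n + 1)).d p q + Pi.π _ n ≫ (S.θ n).1.v p q hpq :=
  rfl

lemma dComponent_comp_θ {p q r : ℤ} (hpq : p + 1 = q) (hqr : q + 1 = r) (n : ℕ) :
    S.dComponent p q hpq n ≫ (S.θ n).1.v q r hqr =
      Pi.π _ n ≫ (S.X n).d p q ≫ (S.θ n).1.v q r hqr := by
  cases n <;> simp [dComponent, S.θ_comp_θ]

/-- The total complex of a sequence of complexes connected by cocycles of degree one. -/
noncomputable def total : Cplx R where
  X p := ∏ᶜ fun n ↦ (S.X n).X p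
  d p q := if hpq : p + 1 = q then Pi.lift (S.dComponent p q hpq) else 0
  shape _ _ h := dif_neg h
  d_comp_d' p q r (hpq : p + 1 = q) (hqr : q + 1 = r) := by
    rw [dif_pos hpq, dif_pos hqr]
    refine Pi.hom_ext _ _ fun n ↦ ?_
    rw [Category.assoc, Pi.lift_π]
    cases n with
    | zero => simp [dComponent]
    | succ n =>
      simp only [dComponent_succ, Preadditive.comp_add, Pi.lift_π_assoc, dComponent_comp_θ]
      simp [v_comp_d _ hpq hqr]

/-- The projection from a term of the total complex to the `n`-th column. -/
noncomputable def totalπ (p : ℤ) (n : ℕ) : S.total.X p ⟶ (S.X n).X p :=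
  Pi.π _ n

variable {S} in
lemma total_hom_ext {P : ModuleCat.{u} R} {p : ℤ} {x y : P ⟶ S.total.X p}
    (h : ∀ n, x ≫ S.totalπ p n = y ≫ S.totalπ p n) : x = y :=
  Pi.hom_ext _ _ h

/-- The morphism to a term of the total complex with given components. -/
noncomputable def totalLift {P : ModuleCat.{u} R} {p : ℤ} (y : ∀ n, P ⟶ (S.X n).X p) :
    P ⟶ S.total.X p :=
  Pi.lift y

@[simp]
lemma totalLift_π {P : ModuleCat.{u} R} {p : ℤ} (y : ∀ n, P ⟶ (S.X n).X p) (n : ℕ) :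
    S.totalLift y ≫ S.totalπ p n = y n :=
  Pi.lift_π y n

@[simp]
lemma totalLift_π_assoc {P P' : ModuleCat.{u} R} {p : ℤ} (y : ∀ n, P ⟶ (S.X n).X p) (n : ℕ)
    (z : (S.X n).X p ⟶ P') : S.totalLift y ≫ S.totalπ p n ≫ z = y n ≫ z :=
  Pi.lift_π_assoc y n z

lemma d_comp_totalπ_zero {p q : ℤ} (hpq : p + 1 = q) :
    S.total.d p q ≫ S.totalπ q 0 = S.totalπ p 0 ≫ (S.X 0).d p q := by
  simp only [total, totalπ, dif_pos hpq, Pi.lift_π, dComponent]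

lemma d_comp_totalπ_succ {p q : ℤ} (hpq : p + 1 = q) (n : ℕ) :
    S.total.d p q ≫ S.totalπ q (n + 1) =
      S.totalπ p (n + 1) ≫ (S.X (n + 1)).d p q + S.totalπ p n ≫ (S.θ n).1.v p q hpq := by
  simp only [total, totalπ, dif_pos hpq, Pi.lift_π]
  rfl

lemma isZero_total {p : ℤ} (hS : ∀ n, IsZero ((S.X n).X p)) : IsZero (S.total.X p) := by
  rw [IsZero.iff_id_eq_zero]
  exact total_hom_ext fun n ↦ (hS n).eq_of_tgt _ _

/-- The morphism to the total complex given by a morphism to the first column which is annihilated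
by the connecting cocycle. -/
noncomputable def augmentation {F : Cplx R} (η : F ⟶ S.X 0)
    (hη : ∀ p q hpq, η.f p ≫ (S.θ 0).1.v p q hpq = 0) : F ⟶ S.total where
  f p := S.totalLift fun
    | 0 => η.f p
    | _ + 1 => 0
  comm' p q hpq := by
    refine total_hom_ext fun n ↦ ?_
    rw [Category.assoc, Category.assoc, totalLift_π]
    match n with
    | 0 => simp [d_comp_totalπ_zero _ hpq]
    | 1 => simp [d_comp_totalπ_succ _ hpq, hη p q hpq]
    | n + 2 => simp [d_comp_totalπ_succ _ hpq]

lemma augmentation_π_zero {F : Cplx R} (η : F ⟶ S.X 0)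
    (hη : ∀ p q hpq, η.f p ≫ (S.θ 0).1.v p q hpq = 0) (p : ℤ) :
    (S.augmentation η hη).f p ≫ S.totalπ p 0 = η.f p :=
  S.totalLift_π _ 0

lemma augmentation_π_succ {F : Cplx R} (η : F ⟶ S.X 0)
    (hη : ∀ p q hpq, η.f p ≫ (S.θ 0).1.v p q hpq = 0) (p : ℤ) (n : ℕ) :
    (S.augmentation η hη).f p ≫ S.totalπ p (n + 1) = 0 :=
  S.totalLift_π _ (n + 1)

lemma isHomExactAt_mappingCone_augmentation_iff {F : Cplx R} (η : F ⟶ S.X 0)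
    (hη : ∀ p q hpq, η.f p ≫ (S.θ 0).1.v p q hpq = 0) {i j k l : ℤ} (hij : i + 1 = j)
    (hjk : j + 1 = k) (hkl : k + 1 = l) : IsHomExactAt (mappingCone (S.augmentation η hη)) j ↔
      ∀ (P : ModuleCat.{u} R) [Module.FinitePresentation R P] (x : P ⟶ F.X k)
        (y : ∀ n, P ⟶ (S.X n).X j), x ≫ F.d k l = 0 → x ≫ η.f k + y 0 ≫ (S.X 0).d j k = 0 →
        (∀ n, y (n + 1) ≫ (S.X (n + 1)).d j k + y n ≫ (S.θ n).1.v j k hjk = 0) →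
        ∃ (x' : P ⟶ F.X j) (y' : ∀ n, P ⟶ (S.X n).X i), x' ≫ F.d j k = -x ∧
          x' ≫ η.f j + y' 0 ≫ (S.X 0).d i j = y 0 ∧
          ∀ n, y' (n + 1) ≫ (S.X (n + 1)).d i j + y' n ≫ (S.θ n).1.v i j hij = y (n + 1) := by
  have cocycle_iff {P : ModuleCat.{u} R} {p q : ℤ} (hpq : p + 1 = q) (x : P ⟶ F.X q)
      (y : P ⟶ S.total.X p) (z : P ⟶ S.total.X q) :
      x ≫ (S.augmentation η hη).f q + y ≫ S.total.d p q = z ↔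
        x ≫ η.f q + (y ≫ S.totalπ p 0) ≫ (S.X 0).d p q = z ≫ S.totalπ q 0 ∧
        ∀ n, (y ≫ S.totalπ p (n + 1)) ≫ (S.X (n + 1)).d p q +
          (y ≫ S.totalπ p n) ≫ (S.θ n).1.v p q hpq = z ≫ S.totalπ q (n + 1) := by
    have ext_iff (a b : P ⟶ S.total.X q) : a = b ↔ a ≫ S.totalπ q 0 = b ≫ S.totalπ q 0 ∧
        ∀ n, a ≫ S.totalπ q (n + 1) = b ≫ S.totalπ q (n + 1) :=
      ⟨fun h ↦ by simp [h], fun h ↦ total_hom_ext fun n ↦ Nat.casesOn n h.1 h.2⟩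
    simp [ext_iff, augmentation_π_zero, augmentation_π_succ, d_comp_totalπ_zero _ hpq,
      d_comp_totalπ_succ _ hpq]
  rw [isHomExactAt_mappingCone_iff hij hjk hkl]
  refine forall₂_congr fun P _ ↦ forall_congr' fun x ↦
    ⟨fun h y hx hxy hy ↦ ?_, fun h y hx hxy ↦ ?_⟩
  · obtain ⟨x', y', h₁, h₂⟩ := h (S.totalLift y) hx
      ((cocycle_iff ..).2 (by simpa using ⟨hxy, hy⟩))
    exact ⟨x', fun n ↦ y' ≫ S.totalπ i n, h₁, by simpa using (cocycle_iff hij ..).1 h₂⟩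
  · obtain ⟨hxy, hy⟩ := (cocycle_iff hjk ..).1 hxy
    obtain ⟨x', y', h₁, h₂⟩ := h (fun n ↦ y ≫ S.totalπ j n) hx (by simpa using hxy)
      (by simpa using hy)
    exact ⟨x', S.totalLift y', h₁, (cocycle_iff ..).2 (by simpa using h₂)⟩

/-- The sequence obtained by discarding the first column. -/
noncomputable abbrev tail : CocycleSequence R where
  X n := S.X (n + 1)
  θ n := S.θ (n + 1)
  θ_comp_θ n _ _ _ := S.θ_comp_θ (n + 1)

/-- Dimension shifting along the pure exact sequence `0 ⟶ F ⟶ S.X 0 ⟶ Q ⟶ 0`. -/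
lemma isHomExactAt_mappingCone_augmentation_of_tail {F Q : Cplx R} {η : F ⟶ S.X 0}
    {π : Cocycle (S.X 0) Q 1} {η' : Q ⟶ S.tail.X 0} {hη} {hη'} {j : ℤ}
    (hθ : ∀ p q hpq, (S.θ 0).1.v p q hpq = π.1.v p q hpq ≫ η'.f q) (hη_mono : ∀ p, Mono (η.f p))
    (w : ∀ p q hpq, η.f p ≫ π.1.v p q hpq = 0)
    (hηπ : ∀ p q hpq, (ShortComplex.mk _ _ (w p q hpq)).Exact)
    (hπ : ∀ p q hpq, IsPureEpi (π.1.v p q hpq).hom)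
    (h : IsHomExactAt (mappingCone (S.tail.augmentation η' hη')) j) :
    IsHomExactAt (mappingCone (S.augmentation η hη)) j := by
  obtain ⟨i, hij⟩ : ∃ i, i + 1 = j := ⟨j - 1, sub_add_cancel j 1⟩
  rw [isHomExactAt_mappingCone_augmentation_iff _ _ _ hij rfl rfl] at h ⊢
  intro P _ x y _ hxy hy
  obtain ⟨z, y', hz, hzy, hy'⟩ := h P (y 0 ≫ π.1.v j _ rfl) (fun n ↦ y (n + 1))
    (by
      rw [Category.assoc, v_comp_d _ rfl rfl, Preadditive.comp_neg, ← Category.assoc,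
        ← neg_eq_of_add_eq_zero_right hxy]
      simp [w])
    (by simpa [add_comm, hθ] using hy 0) (fun n ↦ hy (n + 1))
  obtain ⟨y₀, hy₀⟩ : ∃ y₀ : P ⟶ (S.X 0).X i, y₀ ≫ π.1.v i j hij = z := by
    obtain ⟨y₀, hy₀⟩ := hπ i j hij P z.hom
    exact ⟨ModuleCat.ofHom y₀, ModuleCat.hom_ext hy₀⟩
  have hlift : (y 0 - y₀ ≫ (S.X 0).d i j) ≫ π.1.v j _ rfl = 0 := by
    rw [Preadditive.sub_comp, Category.assoc, ← neg_eq_iff_eq_neg.2 (v_comp_d π hij rfl),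
      Preadditive.comp_neg, ← Category.assoc, hy₀, hz]
    simp
  let x' : P ⟶ F.X j := (hηπ j _ rfl).lift _ hlift
  have hx' : x' ≫ η.f j = y 0 - y₀ ≫ (S.X 0).d i j := (hηπ j _ rfl).lift_f _ hlift
  refine ⟨x', fun | 0 => y₀ | n + 1 => y' n, ?_, by simp [hx'], fun | 0 => ?_ | n + 1 => hy' n⟩
  · rw [← cancel_mono (η.f _), Category.assoc, ← η.comm, ← Category.assoc, hx',
      Preadditive.neg_comp, neg_eq_of_add_eq_zero_right hxy]
    simp
  · simpa [hθ, ← hy₀, add_comm] using hzy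

end CocycleSequence

end Total

section Resolution

/-- The cocycle of degree one connecting the envelope of `F` to that of its cosyzygy. -/
noncomputable def envelopeConnecting (F : Cplx R) :
    Cocycle (envelope F) (envelope (cosyzygy F)) 1 :=
  (toCosyzygy F).postcomp (toEnvelope (cosyzygy F))

lemma envelopeConnecting_v (F : Cplx R) {p q : ℤ} (hpq : p + 1 = q) :
    (envelopeConnecting F).1.v p q hpq =
      (toCosyzygy F).1.v p q hpq ≫ (toEnvelope (cosyzygy F)).f q := by
  simp [envelopeConnecting]

lemma toEnvelope_comp_envelopeConnecting (F : Cplx R) {p q : ℤ} (hpq : p + 1 = q) :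
    (toEnvelope F).f p ≫ (envelopeConnecting F).1.v p q hpq = 0 := by
  rw [envelopeConnecting_v, ← Category.assoc, toEnvelope_comp_toCosyzygy, zero_comp]

lemma envelopeConnecting_comp_envelopeConnecting (F : Cplx R) {p q r : ℤ} (hpq : p + 1 = q)
    (hqr : q + 1 = r) :
    (envelopeConnecting F).1.v p q hpq ≫ (envelopeConnecting (cosyzygy F)).1.v q r hqr = 0 := by
  rw [envelopeConnecting_v, Category.assoc, toEnvelope_comp_envelopeConnecting, comp_zero]

/-- The cocycles of degree one connecting the envelopes of the iterated cosyzygies of `F`. -/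
noncomputable def connecting : ∀ (n : ℕ) (F : Cplx R),
    Cocycle (envelope (cosyzygy^[n] F)) (envelope (cosyzygy^[n + 1] F)) 1
  | 0, F => envelopeConnecting F
  | n + 1, F => connecting n (cosyzygy F)

lemma connecting_comp_connecting (n : ℕ) (F : Cplx R) {p q r : ℤ} (hpq : p + 1 = q)
    (hqr : q + 1 = r) :
    (connecting n F).1.v p q hpq ≫ (connecting (n + 1) F).1.v q r hqr = 0 := by
  induction n generalizing F with
  | zero => exact envelopeConnecting_comp_envelopeConnecting F hpq hqr
  | succ _ ih => exact ih (cosyzygy F)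

/-- The double complex whose columns are the envelopes of the iterated cosyzygies of `F`. If `F` is
bounded below, then its total complex is a pure injective resolution of `F`. -/
noncomputable def resolutionSequence (F : Cplx R) : CocycleSequence R where
  X n := envelope (cosyzygy^[n] F)
  θ n := connecting n F
  θ_comp_θ n _ _ _ := connecting_comp_connecting n F

/-- The augmentation from `F` to the total complex of the envelopes of its cosyzygies. -/
noncomputable def toResolution (F : Cplx R) : F ⟶ (resolutionSequence F).total :=
  (resolutionSequence F).augmentation (toEnvelope F) fun _ _ ↦ toEnvelope_comp_envelopeConnecting F

lemma isZero_resolutionSequence {F : Cplx R} {a : ℤ} (hF : ∀ i < a, IsZero (F.X i)) {i : ℤ}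
    (hi : i < a) (n : ℕ) : IsZero (((resolutionSequence F).X n).X i) := by
  induction n generalizing F with
  | zero => exact isZero_envelope (hF i hi)
  | succ _ ih => exact ih fun j hj ↦ isZero_cosyzygy (sub_add_cancel j 1) (hF _ (by lia))

lemma isHomExactAt_mappingCone_toResolution {F : Cplx R} {a : ℤ} (hF : ∀ i < a, IsZero (F.X i))
    (m : ℕ) {j : ℤ} (hj : j < a + m) : IsHomExactAt (mappingCone (toResolution F)) j := by
  induction m generalizing F a with
  | zero =>
    have hzero := isZero_resolutionSequence hF (i := j) (by simpa using hj)
    refine ((resolutionSequence F).isHomExactAt_mappingCone_augmentation_iff _ _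
      (sub_add_cancel j 1) rfl rfl).2 fun P _ x y _ hxy _ ↦ ?_
    have hx : x = 0 := by
      rw [(hzero 0).eq_of_tgt (y 0) 0, zero_comp, add_zero] at hxy
      exact (cancel_mono ((toEnvelope F).f _)).1 (hxy.trans zero_comp.symm)
    exact ⟨0, 0, by simp [hx], (hzero 0).eq_of_tgt _ _, fun n ↦ (hzero _).eq_of_tgt _ _⟩
  | succ m ih =>
    exact (resolutionSequence F).isHomExactAt_mappingCone_augmentation_of_tail
      (fun _ _ ↦ envelopeConnecting_v F) (fun p ↦ inferInstanceAs (Mono ((toEnvelope F).f p)))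
      (fun _ _ ↦ toEnvelope_comp_toCosyzygy F) (fun _ _ ↦ exact_toCosyzygy F)
      (fun _ _ ↦ isPureEpi_toCosyzygy F)
      (ih (a := a + 1) (fun i hi ↦ isZero_cosyzygy (sub_add_cancel i 1) (hF _ (by lia)))
        (by push_cast at hj; lia))

/-- A morphism to a bounded below complex of pure injective modules whose mapping cone is Hom-exact.
Such a morphism is a pure injective resolution. -/
structure IsBoundedBelowResolution {T I : Cplx R} (f : T ⟶ I) : Prop where
  isBoundedBelow : IsBoundedBelow I
  isPureInjective : ∀ i, IsPureInjective (I.X i)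
  isHomExactAt : ∀ j, IsHomExactAt (mappingCone f) j

lemma IsBoundedBelowResolution.isPureInjectiveResolution {T I : Cplx R} {f : T ⟶ I}
    (hf : IsBoundedBelowResolution f) : IsPureInjectiveResolution f where
  pureInjective := hf.isPureInjective
  pureQuasiIso := isPureAcyclic_of_isHomExactAt hf.isHomExactAt
  kPureInjective := hf.isBoundedBelow.isKPureInjective hf.isPureInjective

lemma IsBoundedBelow.exists_resolution {F : Cplx R} (hF : IsBoundedBelow F) :
    ∃ (I : Cplx R) (f : F ⟶ I), IsBoundedBelowResolution f := by
  obtain ⟨a, ha⟩ := hF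
  exact ⟨_, toResolution F,
    ⟨a, fun i hi ↦ (resolutionSequence F).isZero_total (isZero_resolutionSequence ha hi)⟩,
    fun i ↦ isPureInjective_pi fun n ↦ isPureInjective_envelope _ i,
    fun j ↦ isHomExactAt_mappingCone_toResolution ha (j - a + 1).toNat (by lia)⟩

end Resolution

section Factorization

lemma isHomExactAt_of_homotopy_id_zero {X : Cplx R} (h : Homotopy (𝟙 X) 0) (j : ℤ) :
    IsHomExactAt X j := by
  intro P _ x hx
  have id_eq : 𝟙 (X.X j) = X.d j (j + 1) ≫ h.hom (j + 1) j + h.hom j (j - 1) ≫ X.d (j - 1) j := by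
    have := h.comm j
    rwa [dNext_eq _ (show (ComplexShape.up ℤ).Rel j (j + 1) from rfl),
      prevD_eq _ (show (ComplexShape.up ℤ).Rel (j - 1) j from sub_add_cancel j 1),
      HomologicalComplex.zero_f, add_zero, HomologicalComplex.id_f] at this
  have h_x := x ≫= id_eq
  rw [Preadditive.comp_add, reassoc_of% hx, zero_comp, zero_add, Category.comp_id] at h_x
  exact ⟨x ≫ h.hom j (j - 1), by rw [Category.assoc, ← h_x]⟩

/-- The path complex of `I`: a contractible complex with a degreewise split epimorphism
`mappingCocone.fst` onto `I`, through which the null-homotopic morphisms to `I` factor. -/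
noncomputable abbrev pathComplex (I : Cplx R) : Cplx R := mappingCocone (𝟙 I)

lemma isHomExactAt_pathComplex (I : Cplx R) (j : ℤ) : IsHomExactAt (pathComplex I) j :=
  isHomExactAt_of_homotopy_id_zero
    (((Homotopy.ofEq ((CategoryTheory.shiftFunctor _ _).map_id _).symm).trans
      ((mappingCone.homotopyToZeroOfId I).shift (-1))).trans
        (Homotopy.ofEq ((CategoryTheory.shiftFunctor _ (-1 : ℤ)).map_zero _ _))) j

lemma isPureInjective_pathComplex {I : Cplx R} (hI : ∀ i, IsPureInjective (I.X i)) (i : ℤ) :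
    IsPureInjective ((pathComplex I).X i) :=
  (hI i).of_id_eq_add (hI (i - 1)) (mappingCocone.id_X (𝟙 I) i (i - 1) rfl)

lemma isBoundedBelow_pathComplex {I : Cplx R} (hI : IsBoundedBelow I) :
    IsBoundedBelow (pathComplex I) := by
  obtain ⟨a, ha⟩ := hI
  refine ⟨a, fun i hi ↦ (IsZero.iff_id_eq_zero _).2 ?_⟩
  rw [← mappingCocone.id_X (𝟙 I) i (i - 1) rfl, (ha i hi).eq_of_tgt ((mappingCocone.fst _).f i) 0,
    (ha (i - 1) (by lia)).eq_of_tgt ((mappingCocone.snd _).v i (i - 1) rfl) 0, zero_comp, zero_comp,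
    add_zero]

lemma exists_homotopy_comp {T K I : Cplx R} {ρ : T ⟶ K} (hρ : IsPureQuasiIso ρ)
    (hI : IsKPureInjective I) (φ : T ⟶ I) : ∃ ψ : K ⟶ I, Nonempty (Homotopy (ρ ≫ ψ) φ) := by
  let z : Cocycle (mappingCone ρ) I 1 :=
    Cocycle.mk ((mappingCone.fst ρ).1.comp (Cochain.ofHom φ) (add_zero 1)) 2 rfl (by simp)
  obtain ⟨α, hα⟩ := (isKPureInjective_iff I).1 hI _ hρ 0 1 2 rfl rfl (-z : Cocycle _ _ 1).1
    ((-z).δ_eq_zero 2)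
  let ψ : Cocycle K I 0 :=
    Cocycle.mk ((Cochain.ofHom (mappingCone.inr ρ)).comp α (zero_add 0)) 1 rfl (by
      simp [hα, z])
  refine ⟨ψ.homOf, ⟨(Cochain.equivHomotopy _ _).symm
    ⟨(mappingCone.inl ρ).comp α (add_zero (-1)), ?_⟩⟩⟩
  rw [δ_comp_zero_cochain _ _ 0 rfl, hα]
  simp [ψ, z, Cochain.ofHom_comp]

lemma isHomExactAt_mappingCone_biprod_lift {T K L : Cplx R} {ρ : T ⟶ K} {g : T ⟶ L}
    (hρ : ∀ j, IsHomExactAt (mappingCone ρ) j) (hL : ∀ j, IsHomExactAt L j) (j : ℤ) :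
    IsHomExactAt (mappingCone (biprod.lift ρ g)) j := by
  rw [isHomExactAt_mappingCone_iff (sub_add_cancel j 1) rfl rfl]
  intro P _ x y hx hxy
  have hxy₁ := hxy =≫ (biprod.fst : K ⊞ L ⟶ K).f (j + 1)
  have hxy₂ := hxy =≫ (biprod.snd : K ⊞ L ⟶ L).f (j + 1)
  simp only [Preadditive.add_comp, Category.assoc, ← HomologicalComplex.Hom.comm, zero_comp,
    HomologicalComplex.biprod_lift_fst_f, HomologicalComplex.biprod_lift_snd_f] at hxy₁ hxy₂
  obtain ⟨x', y₁, hx', hy₁⟩ := (isHomExactAt_mappingCone_iff (sub_add_cancel j 1) rfl rfl).1 (hρ j)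
    P x (y ≫ (biprod.fst : K ⊞ L ⟶ K).f j) hx (by rwa [Category.assoc])
  obtain ⟨y₂, hy₂⟩ := (isHomExactAt_iff (sub_add_cancel j 1) rfl).1 (hL j) P
    (y ≫ (biprod.snd : K ⊞ L ⟶ L).f j - x' ≫ g.f j) (by
      rw [Preadditive.sub_comp, Category.assoc, Category.assoc, g.comm, reassoc_of% hx',
        Preadditive.neg_comp, sub_neg_eq_add, add_comm (y ≫ _), hxy₂])
  refine ⟨x', y₁ ≫ (biprod.inl : K ⟶ K ⊞ L).f (j - 1) + y₂ ≫ (biprod.inr : L ⟶ K ⊞ L).f (j - 1),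
    hx', ?_⟩
  apply HomologicalComplex.biprodX_ext_to
  · simpa using hy₁
  · simp [hy₂]

lemma isPureInjective_biprod {K L : Cplx R} (hK : ∀ i, IsPureInjective (K.X i))
    (hL : ∀ i, IsPureInjective (L.X i)) (i : ℤ) : IsPureInjective ((K ⊞ L).X i) :=
  (hK i).of_id_eq_add (hL i) (HomologicalComplex.biprod_total_f K L i)

lemma isBoundedBelow_biprod {K L : Cplx R} (hK : IsBoundedBelow K) (hL : IsBoundedBelow L) :
    IsBoundedBelow (K ⊞ L) := by
  obtain ⟨a, ha⟩ := hK
  obtain ⟨b, hb⟩ := hL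
  refine ⟨min a b, fun i hi ↦ (IsZero.iff_id_eq_zero _).2 ?_⟩
  apply HomologicalComplex.biprodX_ext_to
  · exact (ha i (by lia)).eq_of_tgt _ _
  · exact (hb i (by lia)).eq_of_tgt _ _

lemma exists_factorization {T I : Cplx R} (hT : IsBoundedBelow T) (hI : IsBoundedBelow I)
    (hI' : ∀ i, IsPureInjective (I.X i)) (φ : T ⟶ I) :
    ∃ (J : Cplx R) (f : T ⟶ J) (t : J ⟶ I), IsBoundedBelowResolution f ∧ f ≫ t = φ ∧
      ∀ i, IsSplitEpi (t.f i) := by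
  obtain ⟨K, ρ, hρ⟩ := hT.exists_resolution
  obtain ⟨ψ, ⟨h⟩⟩ := exists_homotopy_comp hρ.isPureInjectiveResolution.pureQuasiIso
    (hI.isKPureInjective hI') φ
  obtain ⟨β, hβ⟩ := Cochain.equivHomotopy _ _ h
  let γ : T ⟶ pathComplex I := mappingCocone.lift (𝟙 I) (φ - ρ ≫ ψ) β (by
    rw [Category.comp_id, Cochain.ofHom_sub, hβ]
    abel)
  refine ⟨K ⊞ pathComplex I, biprod.lift ρ γ, biprod.desc ψ (mappingCocone.fst (𝟙 I)),
    ⟨isBoundedBelow_biprod hρ.isBoundedBelow (isBoundedBelow_pathComplex hI),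
      isPureInjective_biprod hρ.isPureInjective (isPureInjective_pathComplex hI'),
      isHomExactAt_mappingCone_biprod_lift hρ.isHomExactAt (isHomExactAt_pathComplex I)⟩,
    ?_, fun i ↦ .mk' ⟨(mappingCocone.inl (𝟙 I)).v i i (add_zero i) ≫
      (biprod.inr : _ ⟶ K ⊞ pathComplex I).f i, ?_⟩⟩
  · simp [γ]
  · simp

lemma exists_resolution_tower (T : ℕᵒᵖ ⥤ Cplx R) (hT : ∀ n, IsBoundedBelow (T.obj n)) :
    ∃ (S : ℕᵒᵖ ⥤ Cplx R) (f : T ⟶ S), (∀ n, IsBoundedBelowResolution (f.app n)) ∧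
      ∀ (n : ℕ) (i : ℤ), IsSplitEpi ((transition S n).f i) := by
  let Resolution (n : ℕ) := Σ' (I : Cplx R) (f : T.obj (.op n) ⟶ I), IsBoundedBelowResolution f
  have step (n : ℕ) (B : Resolution n) : ∃ (B' : Resolution (n + 1)) (t : B'.1 ⟶ B.1),
      B'.2.1 ≫ t = transition T n ≫ B.2.1 ∧ ∀ i, IsSplitEpi (t.f i) := by
    obtain ⟨I, f, t, hf, hft, hs⟩ := exists_factorization (hT _) B.2.2.isBoundedBelow
      B.2.2.isPureInjective (transition T n ≫ B.2.1)
    exact ⟨⟨I, f, hf⟩, t, hft, hs⟩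
  choose next t ht hs using step
  obtain ⟨I, f, hf⟩ := (hT (.op 0)).exists_resolution
  let B (n : ℕ) : Resolution n := Nat.rec ⟨I, f, hf⟩ next n
  let S : ℕᵒᵖ ⥤ Cplx R := Functor.ofOpSequence (X := fun n ↦ (B n).1) fun n ↦ t n (B n)
  have transition_eq (n : ℕ) : transition S n = t n (B n) :=
    Functor.ofOpSequence_map_homOfLE_succ (X := fun n ↦ (B n).1) _ n
  refine ⟨S, NatTrans.ofOpSequence (fun n ↦ (B n).2.1) fun n ↦ ?_, fun n ↦ (B n.unop).2.2,
    fun n i ↦ ?_⟩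
  · exact (ht n (B n)).symm.trans (congr_arg ((B (n + 1)).2.1 ≫ ·) (transition_eq n).symm)
  · rw [transition_eq]
    exact hs n (B n) i

end Factorization

section Towers

lemma exists_compatible_preimages {V W X : ℕ → Type*} [∀ n, AddCommGroup (V n)]
    [∀ n, AddCommGroup (W n)] [∀ n, AddCommGroup (X n)] (tV : ∀ n, V (n + 1) →+ V n)
    (tW : ∀ n, W (n + 1) →+ W n) (tX : ∀ n, X (n + 1) →+ X n) (a : ∀ n, V n →+ W n)
    (b : ∀ n, W n →+ X n) (ha : ∀ n v, a n (tV n v) = tW n (a (n + 1) v))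
    (hb : ∀ n w, b n (tW n w) = tX n (b (n + 1) w)) (hba : ∀ n v, b n (a n v) = 0)
    (hW : ∀ n w, b n w = 0 → ∃ v, a n v = w) (hV : ∀ n, Function.Surjective (tV n))
    (x : ∀ n, X n) (hx : ∀ n, tX n (x (n + 1)) = x n) (hX : ∀ n, ∃ w, b n w = x n) :
    ∃ w : ∀ n, W n, (∀ n, tW n (w (n + 1)) = w n) ∧ ∀ n, b n (w n) = x n := by
  have exists_preimage_over (n : ℕ) (w : {w // b n w = x n}) :
      ∃ w' : {w // b (n + 1) w = x (n + 1)}, tW n w' = w := by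
    obtain ⟨w', hw'⟩ := hX (n + 1)
    obtain ⟨v, hv⟩ := hW n (tW n w' - w) (by rw [map_sub, hb, hw', hx, w.2, sub_self])
    obtain ⟨v', rfl⟩ := hV n v
    exact ⟨⟨w' - a (n + 1) v', by rw [map_sub, hba, hw', sub_zero]⟩, by simp [← ha, hv]⟩
  choose next hnext using exists_preimage_over
  let w (n : ℕ) : {w // b n w = x n} :=
    Nat.rec ⟨(hX 0).choose, (hX 0).choose_spec⟩ (fun n w ↦ next n w) n
  exact ⟨fun n ↦ (w n).1, fun n ↦ hnext n (w n), fun n ↦ (w n).2⟩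

lemma exists_lift_of_compatible {C : Type*} [Category C] {S : ℕᵒᵖ ⥤ C} {c : Cone S}
    (hc : IsLimit c) {P : C} (w : ∀ n : ℕ, P ⟶ S.obj (.op n))
    (hw : ∀ n : ℕ, w (n + 1) ≫ S.map (homOfLE n.le_succ).op = w n) :
    ∃ l : P ⟶ c.pt, ∀ n : ℕ, l ≫ c.π.app (.op n) = w n :=
  ⟨hc.lift (Cone.mk P (NatTrans.ofOpSequence (F := (Functor.const ℕᵒᵖ).obj P) w fun n ↦ by
    rw [hw]; exact Category.id_comp _)), fun n ↦ hc.fac _ _⟩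

variable {S : ℕᵒᵖ ⥤ Cplx R} {c : Cone S}

lemma exists_lift_X_of_compatible (hc : IsLimit c) {i : ℤ} {P : ModuleCat.{u} R}
    (w : ∀ n : ℕ, P ⟶ (S.obj (.op n)).X i) (hw : ∀ n : ℕ, w (n + 1) ≫ (transition S n).f i = w n) :
    ∃ l : P ⟶ c.pt.X i, ∀ n : ℕ, l ≫ (c.π.app (.op n)).f i = w n :=
  exists_lift_of_compatible (isLimitOfPreserves (HomologicalComplex.eval _ _ i) hc) w hw

lemma hom_ext_X (hc : IsLimit c) {i : ℤ} {P : ModuleCat.{u} R} {x y : P ⟶ c.pt.X i}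
    (h : ∀ n : ℕ, x ≫ (c.π.app (.op n)).f i = y ≫ (c.π.app (.op n)).f i) : x = y :=
  (isLimitOfPreserves (HomologicalComplex.eval _ _ i) hc).hom_ext fun n ↦ h n.unop

/-- Composition of cochains with a morphism of complexes, as an additive map. -/
noncomputable def cochainRightComp (A : Cplx R) {I J : Cplx R} (t : I ⟶ J) (n : ℤ) :
    Cochain A I n →+ Cochain A J n :=
  AddMonoidHom.mk' (fun z ↦ z.comp (Cochain.ofHom t) (add_zero n))
    fun _ _ ↦ Cochain.add_comp _ _ _ _

lemma cochainRightComp_v (A : Cplx R) {I J : Cplx R} (t : I ⟶ J) {n : ℤ} (z : Cochain A I n)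
    {p q : ℤ} (hpq : p + n = q) :
    (cochainRightComp A t n z).v p q hpq = z.v p q hpq ≫ t.f q :=
  Cochain.comp_zero_cochain_v z (Cochain.ofHom t) p q hpq |>.trans (by rw [Cochain.ofHom_v])

lemma δ_cochainRightComp (A : Cplx R) {I J : Cplx R} (t : I ⟶ J) {n m : ℤ} (z : Cochain A I n) :
    δ n m (cochainRightComp A t n z) = cochainRightComp A t m (δ n m z) :=
  δ_comp_ofHom z t m

lemma cochainRightComp_surjective (A : Cplx R) {I J : Cplx R} (t : I ⟶ J)
    (ht : ∀ i, IsSplitEpi (t.f i)) (n : ℤ) : Function.Surjective (cochainRightComp A t n) :=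
  fun z ↦ ⟨Cochain.mk fun p q hpq ↦ z.v p q hpq ≫ section_ (t.f q), Cochain.ext _ _ fun p q hpq ↦ by
    rw [cochainRightComp_v, Cochain.mk_v, Category.assoc, IsSplitEpi.id, Category.comp_id]⟩

lemma cochainRightComp_transition (A : Cplx R) (c : Cone S) (r : ℕ) {n : ℤ}
    (z : Cochain A c.pt n) : cochainRightComp A (transition S r) n
      (cochainRightComp A (c.π.app (.op (r + 1))) n z) =
        cochainRightComp A (c.π.app (.op r)) n z :=
  Cochain.ext _ _ fun p q hpq ↦ by
    rw [cochainRightComp_v, cochainRightComp_v, cochainRightComp_v, Category.assoc,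
      ← HomologicalComplex.comp_f, c.w]

lemma exists_cochain_lift_of_compatible (hc : IsLimit c) {A : Cplx R} {n : ℤ}
    (w : ∀ r : ℕ, Cochain A (S.obj (.op r)) n)
    (hw : ∀ r, cochainRightComp A (transition S r) n (w (r + 1)) = w r) :
    ∃ z : Cochain A c.pt n, ∀ r : ℕ, cochainRightComp A (c.π.app (.op r)) n z = w r := by
  choose l hl using fun (p q : ℤ) (hpq : p + n = q) ↦ exists_lift_X_of_compatible hc
    (fun r ↦ (w r).v p q hpq) fun r ↦ by rw [← cochainRightComp_v, hw]
  exact ⟨Cochain.mk l, fun r ↦ Cochain.ext _ _ fun p q hpq ↦ by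
    rw [cochainRightComp_v, Cochain.mk_v, hl]⟩

lemma cochain_ext_of_isLimit (hc : IsLimit c) {A : Cplx R} {n : ℤ} {z z' : Cochain A c.pt n}
    (h : ∀ r : ℕ, cochainRightComp A (c.π.app (.op r)) n z =
      cochainRightComp A (c.π.app (.op r)) n z') : z = z' :=
  Cochain.ext _ _ fun p q hpq ↦ hom_ext_X hc fun r ↦ by
    rw [← cochainRightComp_v, h r, cochainRightComp_v]

lemma isKPureInjective_of_isLimit (hc : IsLimit c) (hS : ∀ n, IsKPureInjective (S.obj n))
    (hsplit : ∀ (n : ℕ) (i : ℤ), IsSplitEpi ((transition S n).f i)) : IsKPureInjective c.pt := by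
  rw [isKPureInjective_iff]
  intro A hA m n k hmn hnk z hz
  have exists_δ_eq (r : ℕ) := (isKPureInjective_iff _).1 (hS (.op r)) A hA
  obtain ⟨w, hw, hδw⟩ := exists_compatible_preimages
    (V := fun r ↦ Cochain A (S.obj (.op r)) (m - 1)) (W := fun r ↦ Cochain A (S.obj (.op r)) m)
    (X := fun r ↦ Cochain A (S.obj (.op r)) n)
    (fun r ↦ cochainRightComp A (transition S r) (m - 1))
    (fun r ↦ cochainRightComp A (transition S r) m)
    (fun r ↦ cochainRightComp A (transition S r) n)
    (fun r ↦ (δ_hom ℤ A (S.obj (.op r)) (m - 1) m).toAddMonoidHom)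
    (fun r ↦ (δ_hom ℤ A (S.obj (.op r)) m n).toAddMonoidHom)
    (fun r ↦ δ_cochainRightComp A (transition S r))
    (fun r ↦ δ_cochainRightComp A (transition S r))
    (fun r ↦ δ_δ (m - 1) m n)
    (fun r ↦ exists_δ_eq r (m - 1) m n (sub_add_cancel m 1) hmn)
    (fun r ↦ cochainRightComp_surjective A (transition S r) (hsplit r) (m - 1))
    (fun r ↦ cochainRightComp A (c.π.app (.op r)) n z)
    (fun r ↦ cochainRightComp_transition A c r z)
    (fun r ↦ exists_δ_eq r m n k hmn hnk _ (by rw [δ_cochainRightComp, hz, map_zero]))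
  obtain ⟨α, hα⟩ := exists_cochain_lift_of_compatible hc w hw
  refine ⟨α, cochain_ext_of_isLimit hc fun r ↦ ?_⟩
  rw [← δ_cochainRightComp, hα]
  exact hδw r

lemma isPureInjective_of_isLimit {E : ℕᵒᵖ ⥤ ModuleCat.{u} R} {c : Cone E} (hc : IsLimit c)
    (hE : ∀ n, IsPureInjective (E.obj n))
    (hsplit : ∀ n : ℕ, IsSplitEpi (E.map (homOfLE n.le_succ).op)) : IsPureInjective c.pt := by
  have : PreservesLimit E (singleFunctor (ModuleCat.{u} R) 0) :=
    inferInstanceAs (PreservesLimit E (HomologicalComplex.single _ _ 0))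
  have hE' (n) : IsKPureInjective ((E ⋙ singleFunctor (ModuleCat.{u} R) 0).obj n) := hE n
  have hsplit' (n : ℕ) (i : ℤ) :
      IsSplitEpi ((transition (E ⋙ singleFunctor (ModuleCat.{u} R) 0) n).f i) :=
    inferInstanceAs (IsSplitEpi ((HomologicalComplex.eval _ _ i).map
      ((singleFunctor (ModuleCat.{u} R) 0).map (E.map (homOfLE n.le_succ).op))))
  have hK : IsKPureInjective ((singleFunctor (ModuleCat.{u} R) 0).mapCone c).pt :=
    isKPureInjective_of_isLimit (isLimitOfPreserves (singleFunctor (ModuleCat.{u} R) 0) hc)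
      hE' hsplit'
  exact hK

lemma isHomExactAt_of_isLimit (hc : IsLimit c) {j : ℤ} (hj : ∀ n, IsHomExactAt (S.obj n) j)
    (hj' : ∀ n, IsHomExactAt (S.obj n) (j - 1))
    (hsplit : ∀ n, IsSplitEpi ((transition S n).f (j - 1 - 1))) : IsHomExactAt c.pt j := by
  intro P _ x hx
  let X (i : ℤ) (n : ℕ) := P ⟶ (S.obj (.op n)).X i
  let t (i : ℤ) (n : ℕ) : X i (n + 1) →+ X i n := Preadditive.rightComp P ((transition S n).f i)
  let d (i k : ℤ) (n : ℕ) : X i n →+ X k n := Preadditive.rightComp P ((S.obj (.op n)).d i k)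
  have d_t (i k : ℤ) (n : ℕ) (v : X i (n + 1)) : d i k n (t i n v) = t k n (d i k (n + 1) v) := by
    change (v ≫ _) ≫ _ = (v ≫ _) ≫ _
    simp
  have d_d (i k l : ℤ) (n : ℕ) (v : X i n) : d k l n (d i k n v) = 0 := by
    change (v ≫ _) ≫ _ = 0
    simp
  have t_surjective (n : ℕ) : Function.Surjective (t (j - 1 - 1) n) := fun v ↦
    ⟨v ≫ section_ ((transition S n).f (j - 1 - 1)), by
      change (v ≫ _) ≫ _ = v
      simp⟩
  obtain ⟨w, hw, hwx⟩ := exists_compatible_preimages (t (j - 1 - 1)) (t (j - 1)) (t j)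
    (d (j - 1 - 1) (j - 1)) (d (j - 1) j) (d_t _ _) (d_t _ _) (d_d _ _ _)
    (fun n ↦ (isHomExactAt_iff (sub_add_cancel _ 1) (sub_add_cancel j 1)).1 (hj' (.op n)) P)
    t_surjective (fun n ↦ x ≫ (c.π.app (.op n)).f j)
    (fun n ↦ by
      change (x ≫ _) ≫ _ = _
      rw [Category.assoc, ← HomologicalComplex.comp_f, c.w])
    (fun n ↦ hj (.op n) P _ (by
      rw [Category.assoc, HomologicalComplex.Hom.comm, ← Category.assoc]
      exact hx =≫ _ |>.trans zero_comp))
  obtain ⟨y, hy⟩ := exists_lift_X_of_compatible hc w hw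
  refine ⟨y, hom_ext_X hc fun n ↦ ?_⟩
  rw [Category.assoc, ← HomologicalComplex.Hom.comm, reassoc_of% hy n]
  exact hwx n

lemma isHomExactAt_of_isLimit_of_le (hc : IsLimit c) {j : ℤ}
    (hj : ∀ n, IsHomExactAt (S.obj n) j) (hj' : ∀ n, IsHomExactAt (S.obj n) (j - 1)) (N : ℕ)
    (hsplit : ∀ n, N ≤ n → IsSplitEpi ((transition S n).f (j - 1 - 1))) :
    IsHomExactAt c.pt j := by
  have hmono : Monotone (N + ·) := fun _ _ ↦ Nat.add_le_add_left (k := N)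
  have : hmono.functor.Final := hmono.final_functor_iff.2 fun n ↦ ⟨n, Nat.le_add_left n N⟩
  exact isHomExactAt_of_isLimit ((Functor.Initial.isLimitWhiskerEquiv hmono.functor.op c).symm hc)
    (fun n ↦ hj _) (fun n ↦ hj' _) fun n ↦ hsplit (N + n) (N.le_add_right n)

end Towers

section MappingCone

section

variable {T S T' S' : Cplx R} (φ : T ⟶ S) (φ' : T' ⟶ S') (a : T ⟶ T') (b : S ⟶ S')
  (comm : φ ≫ b = a ≫ φ')

lemma mappingCone_map_f_fst_v (i : ℤ) :
    (mappingCone.map φ φ' a b comm).f i ≫ (mappingCone.fst φ').1.v i (i + 1) rfl =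
      (mappingCone.fst φ).1.v i (i + 1) rfl ≫ a.f (i + 1) := by
  simp [mappingCone.map, mappingCone.ext_from_iff _ (i + 1) i rfl]

lemma mappingCone_map_f_snd_v (i : ℤ) :
    (mappingCone.map φ φ' a b comm).f i ≫ (mappingCone.snd φ').v i i (add_zero i) =
      (mappingCone.snd φ).v i i (add_zero i) ≫ b.f i := by
  simp [mappingCone.map, mappingCone.ext_from_iff _ (i + 1) i rfl]

lemma isSplitEpi_mappingCone_map_f (i : ℤ) [IsSplitEpi (a.f (i + 1))] [IsSplitEpi (b.f i)] :
    IsSplitEpi ((mappingCone.map φ φ' a b comm).f i) :=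
  .mk'
    { section_ := (mappingCone.fst φ').1.v i (i + 1) rfl ≫ section_ (a.f (i + 1)) ≫
          (mappingCone.inl φ).v (i + 1) i (by lia) +
        (mappingCone.snd φ').v i i (add_zero i) ≫ section_ (b.f i) ≫ (mappingCone.inr φ).f i
      id := by
        apply mappingCone.ext_to φ' i (i + 1) rfl
        · simp [mappingCone_map_f_fst_v]
        · simp [mappingCone_map_f_snd_v] }

end

variable {J : Type*} [Category J] {T S : J ⥤ Cplx R} (α : T ⟶ S)

/-- The mapping cones of the components of a natural transformation, as a functor. -/
noncomputable def mappingConeFunctor : J ⥤ Cplx R where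
  obj j := mappingCone (α.app j)
  map f := mappingCone.map _ _ (T.map f) (S.map f) (α.naturality f).symm
  map_id j := by
    rw [← mappingCone.map_id]
    congr 1 <;> exact CategoryTheory.Functor.map_id _ j
  map_comp f g := by simp only [Functor.map_comp, ← mappingCone.map_comp]

variable {α} {cT : Cone T} {cS : Cone S}

lemma existsUnique_lift_mappingCone_X [HasLimitsOfShape J (ModuleCat.{u} R)] (hT : IsLimit cT)
    (hS : IsLimit cS) (g : cT.pt ⟶ cS.pt) (hg : ∀ j, g ≫ cS.π.app j = cT.π.app j ≫ α.app j)
    {i : ℤ} {P : ModuleCat.{u} R} (w : ∀ j, P ⟶ (mappingCone (α.app j)).X i)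
    (hw : ∀ ⦃j k⦄ (f : j ⟶ k),
      w j ≫ (mappingCone.map _ _ (T.map f) (S.map f) (α.naturality f).symm).f i = w k) :
    ∃! l : P ⟶ (mappingCone g).X i,
      ∀ j, l ≫ (mappingCone.map _ _ (cT.π.app j) (cS.π.app j) (hg j)).f i = w j := by
  have hT' := isLimitOfPreserves (HomologicalComplex.eval _ _ (i + 1)) hT
  have hS' := isLimitOfPreserves (HomologicalComplex.eval _ _ i) hS
  have fst_map ⦃j k⦄ (f : j ⟶ k) : (w j ≫ (mappingCone.fst (α.app j)).1.v i (i + 1) rfl) ≫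
      (T.map f).f (i + 1) = w k ≫ (mappingCone.fst (α.app k)).1.v i (i + 1) rfl := by
    rw [← hw f, Category.assoc, Category.assoc, mappingCone_map_f_fst_v]
  have snd_map ⦃j k⦄ (f : j ⟶ k) : (w j ≫ (mappingCone.snd (α.app j)).v i i (add_zero i)) ≫
      (S.map f).f i = w k ≫ (mappingCone.snd (α.app k)).v i i (add_zero i) := by
    rw [← hw f, Category.assoc, Category.assoc, mappingCone_map_f_snd_v]
  obtain ⟨x, hx⟩ : ∃ x : P ⟶ cT.pt.X (i + 1), ∀ j, x ≫ (cT.π.app j).f (i + 1) =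
      w j ≫ (mappingCone.fst (α.app j)).1.v i (i + 1) rfl :=
    ⟨hT'.lift (Cone.mk P
      { app j := w j ≫ (mappingCone.fst (α.app j)).1.v i (i + 1) rfl
        naturality _ _ f := (Category.id_comp _).trans (fst_map f).symm }), hT'.fac _⟩
  obtain ⟨y, hy⟩ : ∃ y : P ⟶ cS.pt.X i, ∀ j, y ≫ (cS.π.app j).f i =
      w j ≫ (mappingCone.snd (α.app j)).v i i (add_zero i) :=
    ⟨hS'.lift (Cone.mk P
      { app j := w j ≫ (mappingCone.snd (α.app j)).v i i (add_zero i)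
        naturality _ _ f := (Category.id_comp _).trans (snd_map f).symm }), hS'.fac _⟩
  refine ⟨x ≫ (mappingCone.inl g).v (i + 1) i (by lia) + y ≫ (mappingCone.inr g).f i,
    fun j ↦ mappingCone.ext_to (α.app j) i (i + 1) rfl ?_ ?_,
    fun m hm ↦ ?_⟩
  · simp [mappingCone_map_f_fst_v, ← hx]
  · simp [mappingCone_map_f_snd_v, ← hy]
  · have hmx : m ≫ (mappingCone.fst g).1.v i (i + 1) rfl = x := hT'.hom_ext fun j ↦ by
      refine (Category.assoc _ _ _).trans (.trans ?_ (hx j).symm)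
      rw [← hm j, Category.assoc, mappingCone_map_f_fst_v]
      rfl
    have hmy : m ≫ (mappingCone.snd g).v i i (add_zero i) = y := hS'.hom_ext fun j ↦ by
      refine (Category.assoc _ _ _).trans (.trans ?_ (hy j).symm)
      rw [← hm j, Category.assoc, mappingCone_map_f_snd_v]
      rfl
    exact mappingCone.ext_to g i (i + 1) rfl (by simp [hmx]) (by simp [hmy])

/-- The cone over `mappingConeFunctor α` whose point is the mapping cone of a morphism between
the points of cones over the source and the target of `α`. -/
noncomputable def mappingConeCone (g : cT.pt ⟶ cS.pt)
    (hg : ∀ j, g ≫ cS.π.app j = cT.π.app j ≫ α.app j) : Cone (mappingConeFunctor α) where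
  pt := mappingCone g
  π :=
    { app j := mappingCone.map _ _ (cT.π.app j) (cS.π.app j) (hg j)
      naturality i j f := by
        refine (Category.id_comp _).trans (Eq.trans ?_ (mappingCone.map_comp _ _ _ _ _ (hg i) _ _
          (α.naturality f).symm))
        congr 1
        · exact (cT.w f).symm
        · exact (cS.w f).symm }

/-- Mapping cones commute with limits. -/
noncomputable def isLimitMappingConeCone [HasLimitsOfShape J (ModuleCat.{u} R)] (hT : IsLimit cT)
    (hS : IsLimit cS) (g : cT.pt ⟶ cS.pt) (hg : ∀ j, g ≫ cS.π.app j = cT.π.app j ≫ α.app j) :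
    IsLimit (mappingConeCone g hg) :=
  HomologicalComplex.isLimitOfEval _ _ fun _ ↦ .ofExistsUnique fun s ↦
    existsUnique_lift_mappingCone_X hT hS g hg s.π.app fun _ _ ↦ s.w

end MappingCone

section Truncation

variable (M : Cplx R)

lemma isIso_πTruncGE_f {n i : ℤ} (hi : n < i) : IsIso ((M.πTruncGE n).f i) := by
  have h : (ComplexShape.embeddingUpIntGE n).f (i - n).toNat = i := by
    change n + ((i - n).toNat : ℤ) = i
    lia
  refine ((ComplexShape.embeddingUpIntGE n).isIso_liftExtend_f_iff _
    (HomologicalComplex.restrictionToTruncGE'_hasLift M (ComplexShape.embeddingUpIntGE n)) h).2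
    (HomologicalComplex.isIso_restrictionToTruncGE' _ _ _ ?_)
  rw [ComplexShape.boundaryGE_embeddingUpIntGE_iff]
  lia

lemma isBoundedBelow_truncSystem (n : ℕᵒᵖ) : IsBoundedBelow ((truncSystem M).obj n) :=
  ⟨-(n.unop : ℤ), fun i hi ↦ (M.truncGE (-(n.unop : ℤ))).isZero_of_isStrictlyGE _ i hi⟩

/-- The cone over `truncSystem M` formed by the projections of `M` onto its truncations. -/
noncomputable def truncCone : Cone (truncSystem M) where
  pt := M
  π :=
    { app n := M.πTruncGE (-(n.unop : ℤ))
      naturality _ _ f := (Category.id_comp _).trans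
        (π_truncTransition M (by have := f.unop.le; lia)).symm }

lemma isIso_truncSystem_map_f {m n : ℕᵒᵖ} (f : m ⟶ n) {i : ℤ} (hi : -(n.unop : ℤ) < i) :
    IsIso (((truncSystem M).map f).f i) := by
  have : IsIso (((truncCone M).π.app m).f i) :=
    isIso_πTruncGE_f M (hi.trans_le' (by have := f.unop.le; lia))
  have : IsIso (((truncCone M).π.app n).f i) := isIso_πTruncGE_f M hi
  exact IsIso.of_isIso_fac_left (f := ((truncCone M).π.app m).f i)
    (congr_arg (·.f i) ((truncCone M).w f))

/-- A complex is the limit of its truncations, since these are eventually constant in each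
degree. -/
noncomputable def isLimitTruncCone : IsLimit (truncCone M) :=
  HomologicalComplex.isLimitOfEval _ _ fun i ↦ by
    let n : ℕᵒᵖ := .op ((1 - i).toNat)
    have hn : -(n.unop : ℤ) < i := by dsimp only [n]; lia
    have hF : (truncSystem M ⋙ HomologicalComplex.eval _ _ i).IsEventuallyConstantTo n :=
      fun _ f ↦ isIso_truncSystem_map_f M f hn
    have : IsIso (((HomologicalComplex.eval _ _ i).mapCone (truncCone M)).π.app n) :=
      isIso_πTruncGE_f M hn
    exact hF.isLimitOfIsIso _

variable {M} {S : ℕᵒᵖ ⥤ Cplx R} {c : Cone S}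

lemma isHomExactAt_mappingCone_of_isLimit (hc : IsLimit c) {f : truncSystem M ⟶ S}
    (hf : ∀ n j, IsHomExactAt (mappingCone (f.app n)) j)
    (hsplit : ∀ (n : ℕ) (i : ℤ), IsSplitEpi ((transition S n).f i)) (g : M ⟶ c.pt)
    (hg : ∀ n, g ≫ c.π.app n = M.πTruncGE (-(n.unop : ℤ)) ≫ f.app n) (j : ℤ) :
    IsHomExactAt (mappingCone g) j := by
  refine isHomExactAt_of_isLimit_of_le (isLimitMappingConeCone (isLimitTruncCone M) hc g hg)
    (fun n ↦ hf n j) (fun n ↦ hf n (j - 1)) (2 - j).toNat fun n hn ↦ ?_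
  have := isIso_truncSystem_map_f M (homOfLE n.le_succ).op (i := j - 1 - 1 + 1) (by
    change -(n : ℤ) < _
    lia)
  have := hsplit n (j - 1 - 1)
  exact isSplitEpi_mappingCone_map_f _ _ _ _ (f.naturality _).symm _

lemma isPureInjectiveResolution_of_isLimit (hc : IsLimit c) {f : truncSystem M ⟶ S}
    (hf : ∀ n, IsBoundedBelowResolution (f.app n))
    (hsplit : ∀ (n : ℕ) (i : ℤ), IsSplitEpi ((transition S n).f i)) (g : M ⟶ c.pt)
    (hg : ∀ n, g ≫ c.π.app n = M.πTruncGE (-(n.unop : ℤ)) ≫ f.app n) :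
    IsPureInjectiveResolution g where
  pureInjective i := by
    let ev := HomologicalComplex.eval (ModuleCat.{u} R) (ComplexShape.up ℤ) i
    have hS (n) : IsPureInjective ((S ⋙ ev).obj n) := (hf n).isPureInjective i
    have hlim : IsPureInjective (ev.mapCone c).pt :=
      isPureInjective_of_isLimit (isLimitOfPreserves ev hc) hS fun n ↦ hsplit n i
    exact hlim
  pureQuasiIso := isPureAcyclic_of_isHomExactAt
    (isHomExactAt_mappingCone_of_isLimit hc (fun n ↦ (hf n).isHomExactAt) hsplit g hg)
  kPureInjective := isKPureInjective_of_isLimit hc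
    (fun n ↦ (hf n).isPureInjectiveResolution.kPureInjective) hsplit

end Truncation

section SpecialInverseSystem

lemma nonempty_splitting_kernelSequence {X Y : Cplx R} (p : X ⟶ Y) (i : ℤ) [IsSplitEpi (p.f i)] :
    Nonempty ((kernelSequence p).map
      (HomologicalComplex.eval (ModuleCat.{u} R) (ComplexShape.up ℤ) i)).Splitting :=
  have section_comp : section_ (p.f i) ≫ p.f i = 𝟙 _ := IsSplitEpi.id _
  ⟨ShortComplex.Splitting.ofExactOfSection _ ((ShortComplex.exact_kernel p).map _) _ section_comp
    (inferInstanceAs (Mono ((kernel.ι p).f i)))⟩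

lemma isSpecialInverseSystem_of_isSplitEpi {S : ℕᵒᵖ ⥤ Cplx R}
    (hb : ∀ n, IsBoundedBelow (S.obj n)) (hS : ∀ n i, IsPureInjective ((S.obj n).X i))
    (hsplit : ∀ (n : ℕ) (i : ℤ), IsSplitEpi ((transition S n).f i)) :
    IsSpecialInverseSystem IsKPureInjective S where
  zero := (hb _).isKPureInjective (hS _)
  surjective n i := (ModuleCat.epi_iff_surjective _).1 (hsplit n i).epi
  kernel_mem n := by
    have σ (i : ℤ) := (nonempty_splitting_kernelSequence (transition S n) i).some
    obtain ⟨a, ha⟩ := hb (.op (n + 1))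
    have hker : IsBoundedBelow (kernel (transition S n)) :=
      ⟨a, fun i hi ↦ IsZero.of_mono ((kernel.ι (transition S n)).f i) (ha i hi)⟩
    exact hker.isKPureInjective fun i ↦ (hS (.op (n + 1)) i).of_retract (σ i).f_r
  semiSplit n i := nonempty_splitting_kernelSequence _ i

end SpecialInverseSystem

end PureRes

theorem mainTheorem1 {R : Type u} [CommRing R] (M : CochainComplex (ModuleCat.{u} R) ℤ) :
    ∃ (I : CochainComplex (ModuleCat.{u} R) ℤ) (g : M ⟶ I),
      PureRes.IsPureInjectiveResolution g ∧
      ∃ (S : ℕᵒᵖ ⥤ CochainComplex (ModuleCat.{u} R) ℤ) (f : PureRes.truncSystem M ⟶ S)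
        (p : (Functor.const ℕᵒᵖ).obj I ⟶ S),
        PureRes.IsSpecialInverseSystem PureRes.IsKPureInjective S ∧
        (∀ n : ℕᵒᵖ, PureRes.IsBoundedBelow (S.obj n) ∧
          PureRes.IsPureInjectiveResolution (f.app n)) ∧
        Nonempty (IsLimit (Cone.mk I p)) ∧
        ∀ n : ℕᵒᵖ, g ≫ p.app n = M.πTruncGE (-(n.unop : ℤ)) ≫ f.app n := by
  obtain ⟨S, f, hf, hsplit⟩ := PureRes.exists_resolution_tower (PureRes.truncSystem M)
    (PureRes.isBoundedBelow_truncSystem M)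
  let g : M ⟶ limit S := limit.lift S ((Cone.postcompose f).obj (PureRes.truncCone M))
  have hg (n : ℕᵒᵖ) : g ≫ limit.π S n = M.πTruncGE (-(n.unop : ℤ)) ≫ f.app n :=
    limit.lift_π _ n
  exact ⟨limit S, g, PureRes.isPureInjectiveResolution_of_isLimit (limit.isLimit S) hf hsplit g hg,
    S, f, (limit.cone S).π,
    PureRes.isSpecialInverseSystem_of_isSplitEpi (fun n ↦ (hf n).isBoundedBelow)
      (fun n ↦ (hf n).isPureInjective) hsplit,
    fun n ↦ ⟨(hf n).isBoundedBelow, (hf n).isPureInjectiveResolution⟩, ⟨limit.isLimit S⟩, hg⟩
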